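/- **Problem.** Consider the problem $\mathcal P^{sdd}$: $$\min_{\mathbf x=(\mathbf x_1,\dots,\mathbf x_I)} f(\mathbf x)=\sum_{i=1}^I f_i(\mathbf x_i)\quad\text{s.t.}\quad \sum_i\tilde{\mathbf g}_i(\mathbf x_i)\preceq \mathbf 0,\ \ \sum_i \mathbf A_i\mathbf x_i+\mathbf b=\mathbf 0,\ \ \mathbf g_i(\mathbf x_i)\preceq \mathbf 0,\ \ \mathbf x_i\in\mathcal X_i\ (1\le i\le I),$$ where, for each $i$, $\mathcal X_i\subseteq\mathbb R^{n_i}$ is nonempty, closed, convex and contained in an open set $\mathcal U_i\subseteq\mathbb R^{n_i}$; $f_i:\mathcal U_i\to\mathbb R$, $\tilde{\mathbf g}_i:\mathcal U_i\to\mathbb R^{\tilde r}$ and $\mathbf g_i:\mathcal U_i\to\mathbb R^{r_i}$ are continuously differentiable; $\nabla f_i$ is Lipschitz on $\mathcal X_i$; $\mathbf A_i\in\mathbb R^{\tilde m\times n_i}$, $\mathbf b\in\mathbb R^{\tilde m}$; and $f$ is bounded below on the feasible set. **Stationarity and regularity.** For a problem $\min f$ s.t. $\mathbf g\preceq\mathbf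 0$, $\mathbf h=\mathbf 0$, $\mathbf x\in\mathcal X$, a feasible $\mathbf x$ is *stationary* if there are $\boldsymbol\mu\succeq \mathbf 0$ and $\boldsymbol\lambda$ with $\boldsymbol\mu\odot\mathbf g(\mathbf x)=\mathbf 0$ and $(\nabla f(\mathbf x)+\nabla\mathbf g(\mathbf x)\boldsymbol\mu+\nabla\mathbf h(\mathbf x)\boldsymbol\lambda)^T(\mathbf x'-\mathbf x)\ge0$ for all $\mathbf x'\in\mathcal X$. It is *regular* (MFCQ) if $\boldsymbol\mu\succeq \mathbf 0$, $\mu_j=0$ for inactive $j$, and $(\nabla\mathbf g(\mathbf x)\boldsymbol\mu+\nabla\mathbf h(\mathbf x)\boldsymbol\lambda)^T(\mathbf x'-\mathbf x)\ge0$ for all $\mathbf x'\in\mathcal X$ imply $\boldsymbol\mu=\mathbf 0$, $\boldsymbol\lambda=\mathbf 0$. Assume that all feasible points of $\mathcal P^{sdd}$ are regular. **Approximations.** For each $i$ let $F_i:\mathcal U_i\times\mathcal X_i\to\mathbb R$ be continuously differentiable in the first argument, with $\nabla_{\mathbf x}F_i(\cdot\,;\cdot)$ continuous on $\mathcal U_i\times\mathcal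 X_i$, $\nabla_{\mathbf x}F_i(\mathbf y;\mathbf y)=\nabla f_i(\mathbf y)$ for $\mathbf y\in\mathcal X_i$, and, for some $c_i>0$, $(\mathbf x-\mathbf x')^T(\nabla_{\mathbf x}F_i(\mathbf x;\mathbf y)-\nabla_{\mathbf x}F_i(\mathbf x';\mathbf y))\ge c_i\|\mathbf x-\mathbf x'\|_2^2$ for all $\mathbf x,\mathbf x',\mathbf y\in\mathcal X_i$. Let $(\mathbf g,\mathbf G)$ be either $(\tilde{\mathbf g}_i,\widetilde{\mathbf G}_i)$ or $(\mathbf g_i,\mathbf G_i)$; assume that $\mathbf G(\cdot\,;\mathbf y)$ is (componentwise) convex on $\mathcal X_i$ and differentiable at the points of $\mathcal X_i$, $\mathbf G(\mathbf y;\mathbf y)=\mathbf g(\mathbf y)$, $\mathbf G(\mathbf x;\mathbf y)\succeq\mathbf g(\mathbf x)$ and $\nabla_{\mathbf x}\mathbf G(\mathbf y;\mathbf y)=\nabla\mathbf g(\mathbf y)$ for all $\mathbf x,\mathbf y\in\mathcal X_i$, and that $\mathbf G$ and $\nabla_{\mathbf x}\mathbf G$ are continuous on $\mathcal X_i\times\mathcal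 X_i$. For a feasible point $\mathbf y$ of $\mathcal P^{sdd}$ let $\mathcal P^{sdd}(\mathbf y)$ be the convex problem $$\min_{\mathbf x}\sum_iF_i(\mathbf x_i;\mathbf y_i)\quad\text{s.t.}\quad\sum_i\widetilde{\mathbf G}_i(\mathbf x_i;\mathbf y_i)\preceq \mathbf 0,\ \ \sum_i\mathbf A_i\mathbf x_i+\mathbf b=\mathbf 0,\ \ \mathbf G_i(\mathbf x_i;\mathbf y_i)\preceq\mathbf 0,\ \ \mathbf x_i\in\mathcal X_i.$$ **Inner loop at $\mathbf y$ (projected gradient dual decomposition).** Choose $\tilde{\boldsymbol\mu}^{(0)}\succeq\mathbf 0$, $\tilde{\boldsymbol\lambda}^{(0)}$ and $\gamma_{in}^{(t)}>0$ with $\sum_t\gamma_{in}^{(t)}=\infty$, $\sum_t(\gamma_{in}^{(t)})^2<\infty$. For $t=0,1,\dots$ let $\mathbf u^{(t)}_i$ be an optimal point of the subproblem $$\min_{\mathbf x_i} F_i(\mathbf x_i;\mathbf y_i)+(\tilde{\boldsymbol\mu}^{(t)})^T\widetilde{\mathbf G}_i(\mathbf x_i;\mathbf y_i)+(\tilde{\boldsymbol\lambda}^{(t)})^T\mathbf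 A_i\mathbf x_i\quad\text{s.t.}\quad\mathbf G_i(\mathbf x_i;\mathbf y_i)\preceq\mathbf 0,\ \mathbf x_i\in\mathcal X_i,$$ and set $$\tilde{\boldsymbol\mu}^{(t+1)}=\Big[\tilde{\boldsymbol\mu}^{(t)}+\gamma_{in}^{(t)}\sum_i\widetilde{\mathbf G}_i(\mathbf u_i^{(t)};\mathbf y_i)\Big]_+,\qquad \tilde{\boldsymbol\lambda}^{(t+1)}=\tilde{\boldsymbol\lambda}^{(t)}+\gamma_{in}^{(t)}\Big(\sum_i\mathbf A_i\mathbf u_i^{(t)}+\mathbf b\Big).$$ The output of the inner loop is $\lim_{t}\mathbf u^{(t)}$. **SDD-A.** Start from a feasible point $\mathbf x^{(0)}$ of $\mathcal P^{sdd}$, with step sizes $\gamma^{(k)}\in(0,1]$, $\gamma^{(k)}\to0$, $\sum_k\gamma^{(k)}=\infty$. In iteration $k$ the inner loop at $\mathbf x^{(k)}$ outputs $\mathbf x^{*,(k)}$, and $\mathbf x^{(k+1)}=\mathbf x^{(k)}+\gamma^{(k)}(\mathbf x^{*,(k)}-\mathbf x^{(k)})$. **Statement.** Under these assumptions: 1.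 For every feasible $\mathbf y$, every $\tilde{\boldsymbol\mu}\succeq\mathbf 0$, every $\tilde{\boldsymbol\lambda}$ and every $i$, the $i$-th subproblem at $(\tilde{\boldsymbol\mu},\tilde{\boldsymbol\lambda})$ has a unique optimal point. 2. At every feasible $\mathbf y$, if the gradients $\sum_i\widetilde{\mathbf G}_i(\mathbf u_i^{(t)};\mathbf y_i)$ and $\sum_i\mathbf A_i\mathbf u_i^{(t)}+\mathbf b$ used by the inner loop are bounded in $t$ (as they are when all $\mathcal X_i$ are bounded), then $\mathbf u^{(t)}$ converges. 3. Whenever the iterates $\mathbf u^{(t)}$ of the inner loop at a feasible $\mathbf y$ converge, their limit is the unique optimal point of $\mathcal P^{sdd}(\mathbf y)$. 4. For every sequence $\{\mathbf x^{(k)}\}$ generated by SDD-A that does not satisfy $\|\mathbf x^{(k)}\|\to\infty$ (that is, which has a bounded subsequence), at least one limit point of $\{\mathbf x^{(k)}\}$ exists and is a stationary point of $\mathcal P^{sdd}$. -/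

import Mathlib

open Filter Topology Matrix

noncomputable section

/-! ### Smooth constrained problems, stationary points, regular points -/

/-- The problem `min f(x)` subject to `g_j(x) ≤ 0` (`j : ι`), `h_l(x) = 0` (`l : κ`), `x ∈ X`. -/
structure NLP (E ι κ : Type) where
  f : E → ℝ
  g : ι → E → ℝ
  h : κ → E → ℝ
  X : Set E

namespace NLP

variable {E ι κ : Type}

def feasible (P : NLP E ι κ) : Set E :=
  {x | x ∈ P.X ∧ (∀ j, P.g j x ≤ 0) ∧ (∀ l, P.h l x = 0)}

/-- `x` is an optimal point (global minimizer) of the problem. -/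
def IsOptimal (P : NLP E ι κ) (x : E) : Prop :=
  x ∈ P.feasible ∧ ∀ z ∈ P.feasible, P.f x ≤ P.f z

/-- `x` is an optimal point and there is no other one. -/
def IsUniqueOptimal (P : NLP E ι κ) (x : E) : Prop :=
  P.IsOptimal x ∧ ∀ z, P.IsOptimal z → z = x

variable [NormedAddCommGroup E] [NormedSpace ℝ E] [Fintype ι] [Fintype κ]

/-- The KKT conditions at `x` with multipliers `mu`, `lam`; a product `∇φ(x)ᵀ v` is written
`fderiv ℝ φ x v`. -/
structure IsKKT (P : NLP E ι κ) (x : E) (mu : ι → ℝ) (lam : κ → ℝ) : Prop where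
  stationarity : ∀ z ∈ P.X,
    0 ≤ (fderiv ℝ P.f x + ∑ j, mu j • fderiv ℝ (P.g j) x
      + ∑ l, lam l • fderiv ℝ (P.h l) x) (z - x)
  complementarity : ∀ j, mu j * P.g j x = 0
  nonneg : ∀ j, 0 ≤ mu j
  feasible : x ∈ P.feasible

/-- Stationary points: KKT points. -/
def IsStationary (P : NLP E ι κ) (x : E) : Prop :=
  ∃ (mu : ι → ℝ) (lam : κ → ℝ), P.IsKKT x mu lam

/-- Regular points: feasible points at which the Mangasarian-Fromovitz constraint qualification
holds, in its form with multipliers and an abstract constraint set `X`. -/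
def IsRegular (P : NLP E ι κ) (x : E) : Prop :=
  x ∈ P.feasible ∧
    ∀ (mu : ι → ℝ) (lam : κ → ℝ),
      (∀ z ∈ P.X, 0 ≤ (∑ j, mu j • fderiv ℝ (P.g j) x
        + ∑ l, lam l • fderiv ℝ (P.h l) x) (z - x)) →
      (∀ j, 0 ≤ mu j) → (∀ j, P.g j x ≠ 0 → mu j = 0) →
      mu = 0 ∧ lam = 0

end NLP

/-! ### The separable nonconvex problem with coupling constraints -/

/-- The variable `x = (x_1, …, x_I)` with `x_i ∈ ℝ^{n_i}`. Only the topology and the linear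
structure of this product are used; the blocks carry the Euclidean norm. -/
abbrev BlockVec {I : ℕ} (n : Fin I → ℕ) : Type := ∀ i, EuclideanSpace ℝ (Fin (n i))

/-- Data of the problem
`min ∑ f_i(x_i)` s.t. `∑ gt_i(x_i) ⪯ 0`, `∑ A_i x_i + b = 0`, `g_i(x_i) ⪯ 0`, `x_i ∈ X_i`.
The functions are defined on the sets `U_i`; values elsewhere play no role. -/
structure SDDProblem {I : ℕ} (n r : Fin I → ℕ) (rt m : ℕ) where
  U : ∀ i, Set (EuclideanSpace ℝ (Fin (n i)))
  X : ∀ i, Set (EuclideanSpace ℝ (Fin (n i)))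
  f : ∀ i, EuclideanSpace ℝ (Fin (n i)) → ℝ
  gt : ∀ i, EuclideanSpace ℝ (Fin (n i)) → Fin rt → ℝ
  g : ∀ i, EuclideanSpace ℝ (Fin (n i)) → Fin (r i) → ℝ
  A : ∀ i, Matrix (Fin m) (Fin (n i)) ℝ
  b : Fin m → ℝ

/-- Approximate functions `F_i(x_i; y_i)`, `Gt_i(x_i; y_i)`, `G_i(x_i; y_i)`, the second argument
being the point of approximation. -/
structure SDDApprox {I : ℕ} (n r : Fin I → ℕ) (rt : ℕ) where
  F : ∀ i, EuclideanSpace ℝ (Fin (n i)) → EuclideanSpace ℝ (Fin (n i)) → ℝ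
  Gt : ∀ i, EuclideanSpace ℝ (Fin (n i)) → EuclideanSpace ℝ (Fin (n i)) → Fin rt → ℝ
  G : ∀ i, EuclideanSpace ℝ (Fin (n i)) → EuclideanSpace ℝ (Fin (n i)) → Fin (r i) → ℝ

/-- Conditions on an approximate function `F : U × X → ℝ` of an objective function `f`. -/
structure IsObjectiveApprox {E : Type} [NormedAddCommGroup E] [NormedSpace ℝ E]
    (U X : Set E) (f : E → ℝ) (F : E → E → ℝ) : Prop where
  contDiff : ∀ y ∈ X, ContDiffOn ℝ 1 (fun x => F x y) U
  stronglyConvex : ∃ c : ℝ, 0 < c ∧ ∀ x ∈ X, ∀ x' ∈ X, ∀ y ∈ X,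
    c * ‖x - x'‖ ^ 2 ≤
      (fderiv ℝ (fun z => F z y) x - fderiv ℝ (fun z => F z y) x') (x - x')
  grad_eq : ∀ y ∈ X, fderiv ℝ (fun z => F z y) y = fderiv ℝ f y
  grad_continuous :
    ContinuousOn (fun p : E × E => fderiv ℝ (fun z => F z p.2) p.1) (U ×ˢ X)

/-- Conditions on an approximate function `G` of a (vector) inequality constraint function `g`. -/
structure IsConstraintApprox {E : Type} [NormedAddCommGroup E] [NormedSpace ℝ E] {r : ℕ}
    (X : Set E) (g : E → Fin r → ℝ) (G : E → E → Fin r → ℝ) : Prop where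
  convex : ∀ y ∈ X, ∀ j, ConvexOn ℝ X (fun x => G x y j)
  eq_self : ∀ y ∈ X, G y y = g y
  upper : ∀ x ∈ X, ∀ y ∈ X, ∀ j, g x j ≤ G x y j
  continuous : ContinuousOn (fun p : E × E => G p.1 p.2) (X ×ˢ X)
  differentiable : ∀ x ∈ X, ∀ y ∈ X, DifferentiableAt ℝ (fun z => G z y) x
  grad_eq : ∀ y ∈ X, fderiv ℝ (fun z => G z y) y = fderiv ℝ g y
  grad_continuous :
    ContinuousOn (fun p : E × E => fderiv ℝ (fun z => G z p.2) p.1) (X ×ˢ X)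

namespace SDDProblem

variable {I : ℕ} {n r : Fin I → ℕ} {rt m : ℕ}

/-- `∑ A_i x_i + b`. -/
def coupling (D : SDDProblem n r rt m) (x : BlockVec n) : Fin m → ℝ :=
  ∑ i, D.A i *ᵥ (x i).ofLp + D.b

/-- The nonconvex problem. Its inequality constraints are the `rt` coupling ones, followed by the
`r_i` ones of every block. -/
def toNLP (D : SDDProblem n r rt m) :
    NLP (BlockVec n) (Fin rt ⊕ (Σ i, Fin (r i))) (Fin m) where
  f x := ∑ i, D.f i (x i)
  g := Sum.elim (fun j x => ∑ i, D.gt i (x i) j) (fun s x => D.g s.1 (x s.1) s.2)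
  h l x := D.coupling x l
  X := {x | ∀ i, x i ∈ D.X i}

/-- The convex approximate problem at the point `y`. -/
def approxNLP (D : SDDProblem n r rt m) (S : SDDApprox n r rt) (y : BlockVec n) :
    NLP (BlockVec n) (Fin rt ⊕ (Σ i, Fin (r i))) (Fin m) where
  f x := ∑ i, S.F i (x i) (y i)
  g := Sum.elim (fun j x => ∑ i, S.Gt i (x i) (y i) j) (fun s x => S.G s.1 (x s.1) (y s.1) s.2)
  h l x := D.coupling x l
  X := {x | ∀ i, x i ∈ D.X i}

/-- Standing assumptions on the nonconvex problem. -/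
structure Assumptions (D : SDDProblem n r rt m) : Prop where
  isOpen : ∀ i, IsOpen (D.U i)
  subset : ∀ i, D.X i ⊆ D.U i
  nonempty : ∀ i, (D.X i).Nonempty
  isClosed : ∀ i, IsClosed (D.X i)
  convex : ∀ i, Convex ℝ (D.X i)
  f_contDiff : ∀ i, ContDiffOn ℝ 1 (D.f i) (D.U i)
  f_lipschitz : ∀ i, ∃ K, LipschitzOnWith K (fderiv ℝ (D.f i)) (D.X i)
  gt_contDiff : ∀ i, ContDiffOn ℝ 1 (D.gt i) (D.U i)
  g_contDiff : ∀ i, ContDiffOn ℝ 1 (D.g i) (D.U i)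
  bddBelow : BddBelow (D.toNLP.f '' D.toNLP.feasible)

/-- The approximate functions satisfy their assumptions. -/
structure ApproxAssumptions (D : SDDProblem n r rt m) (S : SDDApprox n r rt) : Prop where
  objective : ∀ i, IsObjectiveApprox (D.U i) (D.X i) (D.f i) (S.F i)
  coupling : ∀ i, IsConstraintApprox (D.X i) (D.gt i) (S.Gt i)
  block : ∀ i, IsConstraintApprox (D.X i) (D.g i) (S.G i)

/-! ### The inner loop: dual decomposition for the convex approximate problem -/

/-- `L_i(x_i, mu, lam; y_i) = F_i(x_i; y_i) + muᵀ Gt_i(x_i; y_i) + lamᵀ A_i x_i`. -/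
def blockLagrangian (D : SDDProblem n r rt m) (S : SDDApprox n r rt) (i : Fin I)
    (y : EuclideanSpace ℝ (Fin (n i))) (mu : Fin rt → ℝ) (lam : Fin m → ℝ)
    (x : EuclideanSpace ℝ (Fin (n i))) : ℝ :=
  S.F i x y + mu ⬝ᵥ S.Gt i x y + lam ⬝ᵥ (D.A i *ᵥ x.ofLp)

/-- `x` is an optimal point of the `i`-th subproblem
`min L_i(·, mu, lam; y_i)` s.t. `G_i(·; y_i) ⪯ 0`, `x_i ∈ X_i`. -/
def IsSubOptimal (D : SDDProblem n r rt m) (S : SDDApprox n r rt) (i : Fin I)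
    (y : EuclideanSpace ℝ (Fin (n i))) (mu : Fin rt → ℝ) (lam : Fin m → ℝ)
    (x : EuclideanSpace ℝ (Fin (n i))) : Prop :=
  (x ∈ D.X i ∧ ∀ j, S.G i x y j ≤ 0) ∧
    ∀ z ∈ D.X i, (∀ j, S.G i z y j ≤ 0) →
      D.blockLagrangian S i y mu lam x ≤ D.blockLagrangian S i y mu lam z

/-- The gradient of the dual function with respect to `mu`, at a dual point whose subproblems have
the optimal points `u_i`. -/
def dualGradMu (_D : SDDProblem n r rt m) (S : SDDApprox n r rt) (y u : BlockVec n) : Fin rt → ℝ :=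
  ∑ i, S.Gt i (u i) (y i)

/-- The gradient of the dual function with respect to `lam`. -/
def dualGradLam (D : SDDProblem n r rt m) (u : BlockVec n) : Fin m → ℝ :=
  D.coupling u

/-- The iterates `(mu^t, lam^t)` and `u^t`, `t ∈ ℕ`, of the inner loop at the outer point `y`: the
projected gradient method for the dual problem, from an arbitrary dual feasible starting point,
where `u^t_i` solves the `i`-th subproblem at `(mu^t, lam^t)`. -/
structure IsInnerRun (D : SDDProblem n r rt m) (S : SDDApprox n r rt) (y : BlockVec n)
    (mu : ℕ → Fin rt → ℝ) (lam : ℕ → Fin m → ℝ) (u : ℕ → BlockVec n) (γin : ℕ → ℝ) : Prop where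
  step_pos : ∀ t, 0 < γin t
  step_sum : Tendsto (fun T => ∑ t ∈ Finset.range T, γin t) atTop atTop
  step_sq : Summable (fun t => γin t ^ 2)
  init : ∀ j, 0 ≤ mu 0 j
  sub : ∀ t i, D.IsSubOptimal S i (y i) (mu t) (lam t) (u t i)
  mu_step : ∀ t j, mu (t + 1) j = max (mu t j + γin t * D.dualGradMu S y (u t) j) 0
  lam_step : ∀ t, lam (t + 1) = lam t + γin t • D.dualGradLam (u t)

/-! ### The outer loop -/

/-- `x` is a sequence generated by the algorithm, with outer step sizes `γ`: in iteration `k` the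
inner loop at `x^k` delivers the limit `xs^k` of its primal iterates, and
`x^{k+1} = x^k + γ^k (xs^k - x^k)`. -/
structure IsSDDRun (D : SDDProblem n r rt m) (S : SDDApprox n r rt)
    (x xs : ℕ → BlockVec n) (γ : ℕ → ℝ) : Prop where
  init : x 0 ∈ D.toNLP.feasible
  step_pos : ∀ k, 0 < γ k
  step_le_one : ∀ k, γ k ≤ 1
  step_tendsto : Tendsto γ atTop (𝓝 0)
  step_sum : Tendsto (fun K => ∑ k ∈ Finset.range K, γ k) atTop atTop
  inner : ∀ k, ∃ mu lam u γin,
    D.IsInnerRun S (x k) mu lam u γin ∧ Tendsto u atTop (𝓝 (xs k))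
  update : ∀ k, x (k + 1) = x k + γ k • (xs k - x k)

end SDDProblem

end

/-! Inner loop. Strong convexity of the objective approximations gives existence and uniqueness of
the optimal points of the subproblems and of the approximate problem at `y`. Separation in finite
dimension gives Fritz John multipliers for the latter. If the weight of the objective were zero, the
multipliers would contradict MFCQ at `y` itself, since `y` is feasible for its own approximate
problem and both problems have the same gradients there; so a saddle point exists
(`exists_isSaddle`). The squared distance of the dual iterates to any dual solution is quasi-Fejér:
up to a summable error it decreases by the step size times a gap that dominates `‖u t - x‖ ^ 2`. The
gap vanishes along a subsequence, and a limit point of the dual iterates along it is again a dual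
solution. The distance to that solution converges, hence tends to zero, and boundedness of the dual
gradients makes the gap vanish along the whole sequence (`tendsto_of_bounded`).

Outer loop. The constraint approximations are convex majorants, so the iterates stay feasible.
Descent of `f`, bounded below, makes `∑ γ k * ‖xs k - x k‖ ^ 2` finite. As `∑ γ k` diverges and the
iterates do not tend to infinity, the directions `xs k - x k` become arbitrarily small at iterates
in a fixed ball (`exists_frequently_norm_le_and_norm_lt`). Along a subsequence `x k` and `xs k` then
have the same limit, and so do Fritz John multipliers normalized to norm one. MFCQ at the limit
makes the weight of the objective positive, which yields the KKT conditions
(`isStationary_of_tendsto`). Continuity of the map from `x k` to `xs k` is never needed. -/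

noncomputable section

/-! ### Tangent inequalities and existence of minimizers. -/

section ConvexCalculus

variable {E : Type*} [NormedAddCommGroup E] [NormedSpace ℝ E]

/-- Only forward steps `t > 0` enter, so this serves at boundary points of a convex set. -/
theorem HasFDerivAt.apply_le_of_forall_segment {φ : E → ℝ} {φ' : E →L[ℝ] ℝ} {x v : E} {M : ℝ}
    (h : HasFDerivAt φ φ' x) (hM : ∀ t : ℝ, 0 < t → t ≤ 1 → φ (x + t • v) - φ x ≤ t * M) :
    φ' v ≤ M := by
  have hl : HasDerivAt (fun t : ℝ => φ (x + t • v)) (φ' v) 0 := h.hasLineDerivAt v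
  have ht := hl.tendsto_slope_zero_right
  refine le_of_tendsto ht ?_
  filter_upwards [Ioc_mem_nhdsGT (zero_lt_one (α := ℝ))] with t ht
  have := hM t ht.1 ht.2
  simp only [zero_add, zero_smul, add_zero, smul_eq_mul]
  rw [inv_mul_le_iff₀ ht.1]
  exact this

theorem ConvexOn.tangent_le {S : Set E} {φ : E → ℝ} {φ' : E →L[ℝ] ℝ} {x z : E}
    (hφ : ConvexOn ℝ S φ) (hx : x ∈ S) (hz : z ∈ S) (h : HasFDerivAt φ φ' x) :
    φ x + φ' (z - x) ≤ φ z := by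
  have := h.apply_le_of_forall_segment (v := z - x) (M := φ z - φ x) fun t h0 h1 => by
    have := hφ.2 hx hz (sub_nonneg.2 h1) h0.le (by ring)
    rw [show (1 - t) • x + t • z = x + t • (z - x) by module] at this
    simp only [smul_eq_mul] at this
    linarith
  linarith

theorem IsMinOn.fderiv_sub_nonneg {S : Set E} {φ : E → ℝ} {φ' : E →L[ℝ] ℝ} {x z : E}
    (hS : Convex ℝ S) (hmin : IsMinOn φ S x) (hx : x ∈ S) (hz : z ∈ S) (h : HasFDerivAt φ φ' x) :
    0 ≤ φ' (z - x) := by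
  have := h.neg.apply_le_of_forall_segment (v := z - x) (M := 0) fun t h0 h1 => by
    have := hmin (hS.add_smul_sub_mem hx hz ⟨h0.le, h1⟩)
    simp only [Set.mem_ofPred_eq] at this
    simp only [Pi.neg_apply]
    linarith
  simpa using this

/-- Subtract from `φ` along the segment its linear part and the claimed quadratic term. Strong
monotonicity makes the derivative of the difference nonnegative, so its value at 0 is at most that
at 1. -/
theorem quadratic_tangent_le {S : Set E} (hS : Convex ℝ S) {φ : E → ℝ} {φ' : E → E →L[ℝ] ℝ}
    {c : ℝ} (hd : ∀ x ∈ S, HasFDerivAt φ (φ' x) x)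
    (hmono : ∀ x ∈ S, ∀ z ∈ S, c * ‖x - z‖ ^ 2 ≤ (φ' x - φ' z) (x - z))
    {x z : E} (hx : x ∈ S) (hz : z ∈ S) :
    φ x + φ' x (z - x) + c / 2 * ‖z - x‖ ^ 2 ≤ φ z := by
  set v := z - x with hv
  let ψ : ℝ → ℝ := fun t => φ (x + t • v) - t * φ' x v - c / 2 * ‖v‖ ^ 2 * t ^ 2
  have hder : ∀ t ∈ Set.Icc (0 : ℝ) 1,
      HasDerivAt ψ (φ' (x + t • v) v - φ' x v - c / 2 * ‖v‖ ^ 2 * (2 * t)) t := by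
    intro t ht
    have hm := hS.add_smul_sub_mem hx hz ht
    have h1 : HasDerivAt (fun s : ℝ => x + s • v) v t := by
      simpa using ((hasDerivAt_id t).smul_const v).const_add x
    have h2 := (hd _ hm).comp_hasDerivAt t h1
    have h3 := (hasDerivAt_id t).mul_const (φ' x v)
    have h4 := (hasDerivAt_pow 2 t).const_mul (c / 2 * ‖v‖ ^ 2)
    refine ((h2.sub h3).sub h4).congr_deriv ?_
    norm_num [hv]
  have hm : MonotoneOn ψ (Set.Icc 0 1) := by
    refine monotoneOn_of_deriv_nonneg (convex_Icc _ _)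
      (fun t ht => (hder t ht).continuousAt.continuousWithinAt)
      (fun t ht => (hder t (interior_subset ht)).differentiableAt.differentiableWithinAt) ?_
    intro t ht
    rw [interior_Icc] at ht
    rw [(hder t ⟨ht.1.le, ht.2.le⟩).deriv]
    have h := hmono _ (hS.add_smul_sub_mem hx hz ⟨ht.1.le, ht.2.le⟩) x hx
    rw [← hv, add_sub_cancel_left, map_smul, norm_smul, Real.norm_of_nonneg ht.1.le,
      smul_eq_mul, _root_.sub_apply] at h
    -- The displacement from `x` is `t • v`, which leaves a common factor `t` to cancel.
    have : t * (c * t * ‖v‖ ^ 2) ≤ t * (φ' (x + t • v) v - φ' x v) := by linarith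
    have := le_of_mul_le_mul_left this ht.1
    linarith
  have := hm (Set.left_mem_Icc.2 zero_le_one) (Set.right_mem_Icc.2 zero_le_one) zero_le_one
  simp only [ψ, zero_smul, one_smul, add_zero, hv, add_sub_cancel] at this
  linarith

theorem convexOn_of_tangent_le {S : Set E} (hS : Convex ℝ S) {φ : E → ℝ} {φ' : E → E →L[ℝ] ℝ}
    (h : ∀ x ∈ S, ∀ z ∈ S, φ x + φ' x (z - x) ≤ φ z) : ConvexOn ℝ S φ := by
  refine ⟨hS, fun x hx z hz a b ha hb hab => ?_⟩
  have hw := hS hx hz ha hb hab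
  set w := a • x + b • z with hwd
  have h1 := mul_le_mul_of_nonneg_left (h w hw x hx) ha
  have h2 := mul_le_mul_of_nonneg_left (h w hw z hz) hb
  have h3 : a * φ' w (x - w) + b * φ' w (z - w) = 0 := by
    have : a • (x - w) + b • (z - w) = 0 := by
      rw [smul_sub, smul_sub, sub_add_sub_comm, ← add_smul, hab, one_smul, hwd, sub_self]
    have := congrArg (φ' w) this
    simpa using this
  have h4 : a * φ w + b * φ w = φ w := by rw [← add_mul, hab, one_mul]
  simp only [smul_eq_mul]
  linarith

end ConvexCalculus

/-- For `‖x - x₀‖ > b / c` the quadratic term beats the linear one, so values below `φ x₀` occur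
only in a compact set. -/
theorem exists_isMinOn_of_quadratic_growth {E : Type*} [NormedAddCommGroup E] [ProperSpace E] {S : Set E} (hS : IsClosed S)
    {φ : E → ℝ} (hφ : ContinuousOn φ S) {x₀ : E} (hx₀ : x₀ ∈ S) {b c : ℝ} (hc : 0 < c)
    (h : ∀ x ∈ S, φ x₀ - b * ‖x - x₀‖ + c * ‖x - x₀‖ ^ 2 ≤ φ x) :
    ∃ x ∈ S, IsMinOn φ S x := by
  refine hφ.exists_isMinOn' hS hx₀ ?_
  have : ∀ᶠ x in cocompact E, b / c < ‖x - x₀‖ := by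
    have h1 := (tendsto_dist_right_cocompact_atTop x₀).eventually_gt_atTop (b / c)
    simpa [dist_eq_norm] using h1
  refine eventually_inf_principal.2 (this.mono fun x hx hxS => ?_)
  have h1 := h x hxS
  rw [div_lt_iff₀ hc] at hx
  nlinarith [norm_nonneg (x - x₀)]

/-! ### Separation and Fritz John multipliers. -/

section Separation

/-- No topological condition on `C` is needed. If the interior is nonempty, separate 0 from it and
pass to the closure. Otherwise `C` lies in a proper affine subspace, on which some nonzero
functional is constant; its sign is free. -/
theorem Convex.exists_ne_zero_nonneg_of_zero_notMem {V : Type*} [NormedAddCommGroup V]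
    [NormedSpace ℝ V] [FiniteDimensional ℝ V] {C : Set V} (hC : Convex ℝ C) (hne : C.Nonempty)
    (h0 : (0 : V) ∉ C) : ∃ ℓ : V →L[ℝ] ℝ, ℓ ≠ 0 ∧ ∀ v ∈ C, 0 ≤ ℓ v := by
  by_cases hint : (interior C).Nonempty
  · obtain ⟨ℓ, hℓ⟩ := geometric_hahn_banach_point_open hC.interior isOpen_interior
      (fun h => h0 (interior_subset h))
    simp only [map_zero] at hℓ
    refine ⟨ℓ, ?_, fun v hv => ?_⟩
    · rintro rfl
      obtain ⟨v, hv⟩ := hint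
      simpa using hℓ v hv
    · have hcl : v ∈ closure (interior C) := by
        rw [hC.closure_interior_eq_closure_of_nonempty_interior hint]
        exact subset_closure hv
      exact closure_minimal (fun w hw => (hℓ w hw).le)
        (isClosed_le continuous_const ℓ.continuous) hcl
  · rw [hC.interior_nonempty_iff_affineSpan_eq_top] at hint
    obtain ⟨p, hp⟩ := hne
    have hdir : (affineSpan ℝ C).direction < ⊤ := by
      refine lt_top_iff_ne_top.2 fun h => hint ?_
      exact (AffineSubspace.direction_eq_top_iff_of_nonempty ⟨p, subset_affineSpan ℝ C hp⟩).1 h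
    obtain ⟨f, hf, hker⟩ := Submodule.exists_le_ker_of_lt_top _ hdir
    have hconst : ∀ v ∈ C, f v = f p := by
      intro v hv
      have : v -ᵥ p ∈ (affineSpan ℝ C).direction :=
        AffineSubspace.vsub_mem_direction (subset_affineSpan ℝ C hv) (subset_affineSpan ℝ C hp)
      have := hker this
      rw [LinearMap.mem_ker, vsub_eq_sub, map_sub, sub_eq_zero] at this
      exact this
    have hF : LinearMap.toContinuousLinearMap f ≠ 0 := by
      intro h
      exact hf (by ext v; simpa using congrArg (fun g => g v) h)
    rcases le_total 0 (f p) with hs | hs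
    · exact ⟨LinearMap.toContinuousLinearMap f, hF, fun v hv => by simpa [hconst v hv] using hs⟩
    · exact ⟨-LinearMap.toContinuousLinearMap f, neg_ne_zero.2 hF,
        fun v hv => by simpa [hconst v hv] using hs⟩

/-- Fritz John multipliers of a convex problem with affine equality constraints. -/
theorem ConvexOn.exists_fritzJohn {E ι κ : Type*} [AddCommGroup E] [Module ℝ E] [Fintype ι]
    [Fintype κ] {X : Set E} {f : E → ℝ} {g : ι → E → ℝ} {h : κ → E → ℝ}
    (hf : ConvexOn ℝ X f) (hg : ∀ j, ConvexOn ℝ X (g j))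
    (hh : ∀ l, ∀ x z : E, ∀ a b : ℝ, a + b = 1 → h l (a • x + b • z) = a * h l x + b * h l z)
    {x : E} (hx : x ∈ X) (hgx : ∀ j, g j x ≤ 0) (hhx : ∀ l, h l x = 0)
    (hmin : ∀ z ∈ X, (∀ j, g j z ≤ 0) → (∀ l, h l z = 0) → f x ≤ f z) :
    ∃ (α : ℝ) (mu : ι → ℝ) (lam : κ → ℝ), (α, mu, lam) ≠ 0 ∧ 0 ≤ α ∧ (∀ j, 0 ≤ mu j) ∧
      (∀ j, mu j * g j x = 0) ∧
      ∀ z ∈ X, α * f x ≤ α * f z + ∑ j, mu j * g j z + ∑ l, lam l * h l z := by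
  classical
  -- Attainable triples of objective excess, constraint bounds and equality residuals. Strictness in
  -- the first entry keeps 0 out of `C`, by optimality of `x`.
  let C : Set (ℝ × (ι → ℝ) × (κ → ℝ)) :=
    {p | ∃ z ∈ X, f z - f x < p.1 ∧ (∀ j, g j z ≤ p.2.1 j) ∧ ∀ l, h l z = p.2.2 l}
  have hC : Convex ℝ C := by
    rintro p ⟨z, hz, h1, h2, h3⟩ q ⟨z', hz', h1', h2', h3'⟩ a b ha hb hab
    refine ⟨a • z + b • z', hf.1 hz hz' ha hb hab, ?_, fun j => ?_, fun l => ?_⟩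
    · have e := hf.2 hz hz' ha hb hab
      simp only [smul_eq_mul] at e
      simp only [Prod.fst_add, Prod.smul_fst, smul_eq_mul]
      have e' : a * (f z - f x) + b * (f z' - f x) < a * p.1 + b * q.1 := by
        rcases ha.eq_or_lt with rfl | ha'
        · have : b = 1 := by linarith
          subst this; linarith
        · have := mul_lt_mul_of_pos_left h1 ha'
          have := mul_le_mul_of_nonneg_left h1'.le hb
          linarith
      have : a * f x + b * f x = f x := by rw [← add_mul, hab, one_mul]
      linarith
    · have e := (hg j).2 hz hz' ha hb hab
      simp only [smul_eq_mul] at e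
      simp only [Prod.snd_add, Prod.fst_add, Prod.smul_snd, Prod.smul_fst, Pi.add_apply,
        Pi.smul_apply, smul_eq_mul]
      have := mul_le_mul_of_nonneg_left (h2 j) ha
      have := mul_le_mul_of_nonneg_left (h2' j) hb
      linarith
    · rw [hh l _ _ _ _ hab, h3, h3']
      simp
  have h0 : (0 : ℝ × (ι → ℝ) × (κ → ℝ)) ∉ C := by
    rintro ⟨z, hz, h1, h2, h3⟩
    have := hmin z hz (by simpa using h2) (by simpa using h3)
    simp only [Prod.fst_zero] at h1
    linarith
  have hxC : ∀ z ∈ X, ∀ ε : ℝ, 0 < ε →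
      ((f z - f x + ε, fun j => g j z, fun l => h l z) : ℝ × (ι → ℝ) × (κ → ℝ)) ∈ C :=
    fun z hz ε hε => ⟨z, hz, by simpa using hε, fun j => le_rfl, fun l => rfl⟩
  obtain ⟨ℓ, hℓ0, hℓ⟩ := hC.exists_ne_zero_nonneg_of_zero_notMem ⟨_, hxC x hx 1 one_pos⟩ h0
  set α := ℓ (1, 0, 0) with hα
  set mu : ι → ℝ := fun j => ℓ (0, Pi.single j 1, 0) with hmu
  set lam : κ → ℝ := fun l => ℓ (0, 0, Pi.single l 1) with hlam
  have hrep : ∀ p : ℝ × (ι → ℝ) × (κ → ℝ),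
      ℓ p = α * p.1 + ∑ j, mu j * p.2.1 j + ∑ l, lam l * p.2.2 l := by
    rintro ⟨s, v, w⟩
    have e : ((s, v, w) : ℝ × (ι → ℝ) × (κ → ℝ)) = s • ((1, 0, 0) : ℝ × (ι → ℝ) × (κ → ℝ))
        + ∑ j, v j • ((0, Pi.single j 1, 0) : ℝ × (ι → ℝ) × (κ → ℝ))
        + ∑ l, w l • ((0, 0, Pi.single l 1) : ℝ × (ι → ℝ) × (κ → ℝ)) := by
      ext i
      · simp [Prod.fst_sum]
      · simp [Prod.fst_sum, Prod.snd_sum, Finset.sum_apply, Pi.single_apply]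
      · simp [Prod.snd_sum, Finset.sum_apply, Pi.single_apply]
    rw [e, map_add, map_add, map_smul, map_sum, map_sum]
    simp only [map_smul, smul_eq_mul, ← e]
    simp only [hα, hmu, hlam, mul_comm]
  -- `C` is stable under increasing its first two components, so the separating functional is
  -- bounded below along these rays and has nonnegative slope on them.
  have nonneg_of : ∀ d : ℝ, ∀ s : ℝ, (∀ N : ℝ, 0 ≤ N → 0 ≤ s + N * d) → 0 ≤ d := by
    intro d s H
    by_contra! hd
    have := H ((|s| + 1) / (-d)) (by have := abs_nonneg s; apply div_nonneg <;> linarith)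
    have e : (|s| + 1) / (-d) * d = -(|s| + 1) := by
      have := hd.ne
      rw [div_neg, neg_mul, div_mul_cancel₀ _ this]
    rw [e] at this
    linarith [le_abs_self s]
  have hα0 : 0 ≤ α := by
    refine nonneg_of α (ℓ (f x - f x + 1, fun j => g j x, fun l => h l x)) fun N hN => ?_
    have := hℓ _ (hxC x hx (1 + N) (by linarith))
    rw [hrep] at this ⊢
    simp only at this ⊢
    linarith
  have hmu0 : ∀ j, 0 ≤ mu j := by
    intro j
    refine nonneg_of (mu j) (ℓ (f x - f x + 1, fun j => g j x, fun l => h l x)) fun N hN => ?_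
    have hm : ((f x - f x + 1, (fun j => g j x) + N • Pi.single j 1, fun l => h l x) :
        ℝ × (ι → ℝ) × (κ → ℝ)) ∈ C := by
      refine ⟨x, hx, by simp, fun i => ?_, fun l => rfl⟩
      simp only [Pi.add_apply, Pi.smul_apply, Pi.single_apply, smul_eq_mul]
      split_ifs <;> linarith
    have := hℓ _ hm
    rw [hrep] at this ⊢
    simp only [Pi.add_apply, Pi.smul_apply, Pi.single_apply, smul_eq_mul, mul_add,
      Finset.sum_add_distrib, mul_ite, mul_one, mul_zero, Finset.sum_ite_eq', Finset.mem_univ,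
      if_true] at this ⊢
    linarith
  have hmain : ∀ z ∈ X, α * f x ≤ α * f z + ∑ j, mu j * g j z + ∑ l, lam l * h l z := by
    intro z hz
    refine le_of_forall_pos_le_add fun ε hε => ?_
    -- The strict first entry of `C` costs a slack; `α + 1` serves as divisor because `α` may
    -- vanish.
    have := hℓ _ (hxC z hz (ε / (α + 1)) (by positivity))
    rw [hrep] at this
    simp only at this
    have h1 : α * (ε / (α + 1)) ≤ ε := by
      rw [mul_div_assoc', div_le_iff₀ (by positivity)]
      nlinarith
    nlinarith
  refine ⟨α, mu, lam, ?_, hα0, hmu0, ?_, hmain⟩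
  · intro H
    apply hℓ0
    simp only [Prod.mk_eq_zero] at H
    ext p <;> simp [hrep, H.1, H.2.1, H.2.2]
  · have h1 := hmain x hx
    simp only [hhx, mul_zero, Finset.sum_const_zero, add_zero] at h1
    have h2 : ∀ j ∈ Finset.univ, mu j * g j x ≤ 0 := fun j _ =>
      mul_nonpos_of_nonneg_of_nonpos (hmu0 j) (hgx j)
    have h3 : ∑ j, mu j * g j x = 0 := le_antisymm (Finset.sum_nonpos h2) (by linarith)
    intro j
    exact (Finset.sum_eq_zero_iff_of_nonpos h2).1 h3 j (Finset.mem_univ j)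

end Separation

/-! ### Quasi-Fejér sequences. -/

section QuasiFejer

variable {V a e γ : ℕ → ℝ}

theorem sum_mul_le_of_quasiFejer (h : ∀ t, V (t + 1) + γ t * a t ≤ V t + e t) (T : ℕ) :
    V T + ∑ t ∈ Finset.range T, γ t * a t ≤ V 0 + ∑ t ∈ Finset.range T, e t := by
  induction T with
  | zero => simp
  | succ T ih =>
    rw [Finset.sum_range_succ, Finset.sum_range_succ]
    linarith [h T]

/-- Subtracting the accumulated errors turns `V` into a decreasing sequence bounded below. -/
theorem exists_tendsto_of_quasiFejer (hV : ∀ t, 0 ≤ V t) (ha : ∀ t, 0 ≤ a t)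
    (hγ : ∀ t, 0 < γ t) (he0 : ∀ t, 0 ≤ e t) (he : Summable e)
    (h : ∀ t, V (t + 1) + γ t * a t ≤ V t + e t) : ∃ ℓ, Tendsto V atTop (𝓝 ℓ) := by
  let W : ℕ → ℝ := fun T => V T - ∑ t ∈ Finset.range T, e t
  have hW : Antitone W := by
    refine antitone_nat_of_succ_le fun T => ?_
    simp only [W, Finset.sum_range_succ]
    have := mul_nonneg (hγ T).le (ha T)
    linarith [h T]
  have hb : BddBelow (Set.range W) := by
    refine ⟨-∑' t, e t, ?_⟩
    rintro _ ⟨T, rfl⟩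
    have := he.sum_le_tsum (Finset.range T) (fun t _ => he0 t)
    simp only [W]
    linarith [hV T]
  have h1 := tendsto_atTop_ciInf hW hb
  have h2 := h1.add he.hasSum.tendsto_sum_nat
  exact ⟨_, by simpa [W] using h2⟩

/-- The sums of `γ t * a t` are bounded by `V 0 + ∑' t, e t`, whereas `a ≥ ε` from some index on
would make them diverge with `∑ γ`. -/
theorem frequently_lt_of_quasiFejer (hV : ∀ t, 0 ≤ V t) (ha : ∀ t, 0 ≤ a t)
    (hγ : ∀ t, 0 < γ t) (hγs : Tendsto (fun T => ∑ t ∈ Finset.range T, γ t) atTop atTop)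
    (he0 : ∀ t, 0 ≤ e t) (he : Summable e)
    (h : ∀ t, V (t + 1) + γ t * a t ≤ V t + e t) {ε : ℝ} (hε : 0 < ε) :
    ∃ᶠ t in atTop, a t < ε := by
  intro hn
  obtain ⟨N, hN⟩ := eventually_atTop.1 hn
  obtain ⟨T, hT, hTN⟩ := ((hγs.eventually_gt_atTop
    ((V 0 + ∑' t, e t) / ε + ∑ t ∈ Finset.range N, γ t)).and (eventually_ge_atTop N)).exists
  have h1 := sum_mul_le_of_quasiFejer h T
  have h2 := he.sum_le_tsum (Finset.range T) (fun t _ => he0 t)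
  rw [← Finset.sum_range_add_sum_Ico _ hTN] at h1 hT
  have h3 : 0 ≤ ∑ t ∈ Finset.range N, γ t * a t :=
    Finset.sum_nonneg fun t _ => mul_nonneg (hγ t).le (ha t)
  have h4 : (∑ t ∈ Finset.Ico N T, γ t) * ε ≤ ∑ t ∈ Finset.Ico N T, γ t * a t := by
    rw [Finset.sum_mul]
    refine Finset.sum_le_sum fun t ht => mul_le_mul_of_nonneg_left ?_ (hγ t).le
    exact not_lt.1 (hN t (Finset.mem_Ico.1 ht).1)
  have h5 : (V 0 + ∑' t, e t) / ε < ∑ t ∈ Finset.Ico N T, γ t := by linarith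
  rw [div_lt_iff₀ hε] at h5
  linarith [hV T]

end QuasiFejer

theorem NLP.isClosed_feasible {E ι κ : Type} [TopologicalSpace E] (P : NLP E ι κ)
    (hX : IsClosed P.X) (hg : ∀ j, ContinuousOn (P.g j) P.X)
    (hh : ∀ l, ContinuousOn (P.h l) P.X) : IsClosed P.feasible := by
  have : P.feasible = P.X ∩ (⋂ j, P.X ∩ P.g j ⁻¹' Set.Iic 0) ∩ ⋂ l, P.X ∩ P.h l ⁻¹' {0} := by
    ext x
    simp only [NLP.feasible, Set.mem_ofPred_eq, Set.mem_inter_iff, Set.mem_iInter,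
      Set.mem_preimage, Set.mem_Iic, Set.mem_singleton_iff]
    exact ⟨fun h => ⟨⟨h.1, fun j => ⟨h.1, h.2.1 j⟩⟩, fun l => ⟨h.1, h.2.2 l⟩⟩,
      fun h => ⟨h.1.1, fun j => (h.1.2 j).2, fun l => (h.2 l).2⟩⟩
  rw [this]
  exact (hX.inter (isClosed_iInter fun j => (hg j).preimage_isClosed_of_isClosed hX isClosed_Iic)).inter
    (isClosed_iInter fun l => (hh l).preimage_isClosed_of_isClosed hX isClosed_singleton)

/-! ### Block structure: derivatives, convexity and the subproblems. -/

section Blocks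

variable {I : ℕ} {n r : Fin I → ℕ} {rt m : ℕ}

/-- `BlockVec n` carries the sup norm over blocks, whereas strong convexity produces the sum of
squares. -/
theorem sq_norm_le_sum_sq_norm (v : BlockVec n) : ‖v‖ ^ 2 ≤ ∑ i, ‖v i‖ ^ 2 := by
  have h0 : 0 ≤ ∑ i, ‖v i‖ ^ 2 := Finset.sum_nonneg fun i _ => sq_nonneg _
  have : ‖v‖ ≤ √(∑ i, ‖v i‖ ^ 2) := by
    refine (pi_norm_le_iff_of_nonneg (Real.sqrt_nonneg _)).2 fun i => ?_
    exact Real.le_sqrt_of_sq_le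
      (Finset.single_le_sum (f := fun i => ‖v i‖ ^ 2) (fun i _ => sq_nonneg _) (Finset.mem_univ i))
  calc ‖v‖ ^ 2 ≤ √(∑ i, ‖v i‖ ^ 2) ^ 2 := by gcongr
    _ = _ := Real.sq_sqrt h0

/-- The functional `v ↦ ∑ i, φ' i (v i)`. -/
def blockSum (φ' : ∀ i, EuclideanSpace ℝ (Fin (n i)) →L[ℝ] ℝ) : BlockVec n →L[ℝ] ℝ :=
  ∑ i, (φ' i).comp (ContinuousLinearMap.proj i)

theorem blockSum_apply (φ' : ∀ i, EuclideanSpace ℝ (Fin (n i)) →L[ℝ] ℝ) (v : BlockVec n) :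
    blockSum φ' v = ∑ i, φ' i (v i) := by
  simp [blockSum]

theorem continuous_blockSum : Continuous (blockSum (n := n)) := by
  unfold blockSum
  fun_prop

theorem hasFDerivAt_blockSum {φ : ∀ i, EuclideanSpace ℝ (Fin (n i)) → ℝ}
    {φ' : ∀ i, EuclideanSpace ℝ (Fin (n i)) →L[ℝ] ℝ} {x : BlockVec n}
    (h : ∀ i, HasFDerivAt (φ i) (φ' i) (x i)) :
    HasFDerivAt (fun z : BlockVec n => ∑ i, φ i (z i)) (blockSum φ') x := by
  unfold blockSum
  refine HasFDerivAt.fun_sum fun i _ => ?_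
  exact HasFDerivAt.comp (g := φ i) (f := fun z : BlockVec n => z i) x (h i)
    (hasFDerivAt_apply i x)

/-- Derivatives of the inequality constraints, from those of the blocks. -/
def blockConstraintDeriv
    (Gt' : ∀ i, EuclideanSpace ℝ (Fin (n i)) →L[ℝ] (Fin rt → ℝ))
    (G' : ∀ i, EuclideanSpace ℝ (Fin (n i)) →L[ℝ] (Fin (r i) → ℝ)) :
    Fin rt ⊕ (Σ i, Fin (r i)) → BlockVec n →L[ℝ] ℝ :=
  Sum.elim (fun j => blockSum fun i => (ContinuousLinearMap.proj j).comp (Gt' i))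
    (fun s => ((ContinuousLinearMap.proj s.2).comp (G' s.1)).comp
      (ContinuousLinearMap.proj (φ := fun i => EuclideanSpace ℝ (Fin (n i))) s.1))

theorem hasFDerivAt_blockConstraint
    {Gt : ∀ i, EuclideanSpace ℝ (Fin (n i)) → Fin rt → ℝ}
    {G : ∀ i, EuclideanSpace ℝ (Fin (n i)) → Fin (r i) → ℝ}
    {Gt' : ∀ i, EuclideanSpace ℝ (Fin (n i)) →L[ℝ] (Fin rt → ℝ)}
    {G' : ∀ i, EuclideanSpace ℝ (Fin (n i)) →L[ℝ] (Fin (r i) → ℝ)} {x : BlockVec n}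
    (ht : ∀ i, HasFDerivAt (Gt i) (Gt' i) (x i)) (hG : ∀ i, HasFDerivAt (G i) (G' i) (x i))
    (j : Fin rt ⊕ (Σ i, Fin (r i))) :
    HasFDerivAt ((Sum.elim (fun j x => ∑ i, Gt i (x i) j) (fun s x => G s.1 (x s.1) s.2) :
      Fin rt ⊕ (Σ i, Fin (r i)) → BlockVec n → ℝ) j) (blockConstraintDeriv Gt' G' j) x := by
  rcases j with j | ⟨i, j⟩
  · exact hasFDerivAt_blockSum (φ := fun i z => Gt i z j)
      fun i => hasFDerivAt_pi'.1 (ht i) j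
  · exact HasFDerivAt.comp (g := fun z => G i z j) (f := fun z : BlockVec n => z i) x
      (hasFDerivAt_pi'.1 (hG i) j) (hasFDerivAt_apply i x)

namespace SDDProblem

variable {D : SDDProblem n r rt m} {S : SDDApprox n r rt}

/-- Linear part of the coupling equality constraints. -/
def couplingLin (D : SDDProblem n r rt m) (l : Fin m) : BlockVec n →L[ℝ] ℝ :=
  blockSum fun i => ∑ k, D.A i l k • EuclideanSpace.proj k

theorem coupling_apply (D : SDDProblem n r rt m) (x : BlockVec n) (l : Fin m) :
    D.coupling x l = D.couplingLin l x + D.b l := by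
  simp [coupling, couplingLin, blockSum_apply, Matrix.mulVec, dotProduct, Finset.sum_apply]

theorem hasFDerivAt_coupling (D : SDDProblem n r rt m) (x : BlockVec n) (l : Fin m) :
    HasFDerivAt (fun z => D.coupling z l) (D.couplingLin l) x := by
  simp only [coupling_apply]
  exact (D.couplingLin l).hasFDerivAt.add_const _

theorem continuous_coupling (D : SDDProblem n r rt m) : Continuous D.coupling := by
  refine continuous_pi fun l => ?_
  simp only [coupling_apply]
  fun_prop

theorem coupling_affine (D : SDDProblem n r rt m) (l : Fin m) (x z : BlockVec n) (a b : ℝ)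
    (hab : a + b = 1) :
    D.coupling (a • x + b • z) l = a * D.coupling x l + b * D.coupling z l := by
  simp only [coupling_apply, map_add, map_smul, smul_eq_mul]
  linear_combination -(D.b l) * hab

/-- `lamᵀ (∑ A_i x_i + b)`, block by block. -/
theorem dotProduct_coupling (D : SDDProblem n r rt m) (lam : Fin m → ℝ) (x : BlockVec n) :
    lam ⬝ᵥ D.coupling x = ∑ i, lam ⬝ᵥ (D.A i *ᵥ (x i).ofLp) + lam ⬝ᵥ D.b := by
  simp only [coupling, dotProduct_add, dotProduct_sum]

theorem Assumptions.convex_X (hD : D.Assumptions) : Convex ℝ D.toNLP.X := by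
  intro x hx z hz a b ha hb hab i
  exact hD.convex i (hx i) (hz i) ha hb hab

theorem Assumptions.isClosed_X (hD : D.Assumptions) : IsClosed D.toNLP.X := by
  have : D.toNLP.X = ⋂ i, (fun x : BlockVec n => x i) ⁻¹' D.X i := by
    ext x; simp [toNLP]
  rw [this]
  exact isClosed_iInter fun i => (hD.isClosed i).preimage (continuous_apply i)

theorem Assumptions.mem_nhds (hD : D.Assumptions) {i : Fin I}
    {x : EuclideanSpace ℝ (Fin (n i))} (hx : x ∈ D.X i) : D.U i ∈ 𝓝 x :=
  (hD.isOpen i).mem_nhds (hD.subset i hx)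

theorem Assumptions.hasFDerivAt_f (hD : D.Assumptions) {i : Fin I}
    {x : EuclideanSpace ℝ (Fin (n i))} (hx : x ∈ D.X i) :
    HasFDerivAt (D.f i) (fderiv ℝ (D.f i) x) x :=
  (((hD.f_contDiff i).contDiffAt (hD.mem_nhds hx)).differentiableAt one_ne_zero).hasFDerivAt

theorem Assumptions.hasFDerivAt_gt (hD : D.Assumptions) {i : Fin I}
    {x : EuclideanSpace ℝ (Fin (n i))} (hx : x ∈ D.X i) :
    HasFDerivAt (D.gt i) (fderiv ℝ (D.gt i) x) x :=
  (((hD.gt_contDiff i).contDiffAt (hD.mem_nhds hx)).differentiableAt one_ne_zero).hasFDerivAt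

theorem Assumptions.hasFDerivAt_g (hD : D.Assumptions) {i : Fin I}
    {x : EuclideanSpace ℝ (Fin (n i))} (hx : x ∈ D.X i) :
    HasFDerivAt (D.g i) (fderiv ℝ (D.g i) x) x :=
  (((hD.g_contDiff i).contDiffAt (hD.mem_nhds hx)).differentiableAt one_ne_zero).hasFDerivAt

theorem ApproxAssumptions.hasFDerivAt_F (hS : D.ApproxAssumptions S) (hD : D.Assumptions)
    {i : Fin I} {x y : EuclideanSpace ℝ (Fin (n i))} (hx : x ∈ D.X i) (hy : y ∈ D.X i) :
    HasFDerivAt (fun z => S.F i z y) (fderiv ℝ (fun z => S.F i z y) x) x :=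
  ((((hS.objective i).contDiff y hy).contDiffAt (hD.mem_nhds hx)).differentiableAt
    one_ne_zero).hasFDerivAt

theorem ApproxAssumptions.hasFDerivAt_Gt (hS : D.ApproxAssumptions S)
    {i : Fin I} {x y : EuclideanSpace ℝ (Fin (n i))} (hx : x ∈ D.X i) (hy : y ∈ D.X i) :
    HasFDerivAt (fun z => S.Gt i z y) (fderiv ℝ (fun z => S.Gt i z y) x) x :=
  ((hS.coupling i).differentiable x hx y hy).hasFDerivAt

theorem ApproxAssumptions.hasFDerivAt_G (hS : D.ApproxAssumptions S)
    {i : Fin I} {x y : EuclideanSpace ℝ (Fin (n i))} (hx : x ∈ D.X i) (hy : y ∈ D.X i) :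
    HasFDerivAt (fun z => S.G i z y) (fderiv ℝ (fun z => S.G i z y) x) x :=
  ((hS.block i).differentiable x hx y hy).hasFDerivAt

/-! ### Derivatives of the two problems -/

theorem Assumptions.hasFDerivAt_toNLP_f (hD : D.Assumptions) {x : BlockVec n}
    (hx : x ∈ D.toNLP.X) :
    HasFDerivAt D.toNLP.f (blockSum fun i => fderiv ℝ (D.f i) (x i)) x :=
  hasFDerivAt_blockSum fun i => hD.hasFDerivAt_f (hx i)

theorem Assumptions.hasFDerivAt_toNLP_g (hD : D.Assumptions) {x : BlockVec n}
    (hx : x ∈ D.toNLP.X) (j : Fin rt ⊕ (Σ i, Fin (r i))) :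
    HasFDerivAt (D.toNLP.g j) (blockConstraintDeriv (fun i => fderiv ℝ (D.gt i) (x i))
      (fun i => fderiv ℝ (D.g i) (x i)) j) x :=
  hasFDerivAt_blockConstraint (fun i => hD.hasFDerivAt_gt (hx i))
    (fun i => hD.hasFDerivAt_g (hx i)) j

theorem ApproxAssumptions.hasFDerivAt_approxNLP_f (hS : D.ApproxAssumptions S)
    (hD : D.Assumptions) {x y : BlockVec n} (hx : x ∈ D.toNLP.X) (hy : y ∈ D.toNLP.X) :
    HasFDerivAt (D.approxNLP S y).f
      (blockSum fun i => fderiv ℝ (fun z => S.F i z (y i)) (x i)) x :=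
  hasFDerivAt_blockSum (φ := fun i z => S.F i z (y i)) fun i => hS.hasFDerivAt_F hD (hx i) (hy i)

theorem ApproxAssumptions.hasFDerivAt_approxNLP_g (hS : D.ApproxAssumptions S)
    {x y : BlockVec n} (hx : x ∈ D.toNLP.X) (hy : y ∈ D.toNLP.X)
    (j : Fin rt ⊕ (Σ i, Fin (r i))) :
    HasFDerivAt ((D.approxNLP S y).g j)
      (blockConstraintDeriv (fun i => fderiv ℝ (fun z => S.Gt i z (y i)) (x i))
        (fun i => fderiv ℝ (fun z => S.G i z (y i)) (x i)) j) x :=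
  hasFDerivAt_blockConstraint (Gt := fun i z => S.Gt i z (y i)) (G := fun i z => S.G i z (y i))
    (fun i => hS.hasFDerivAt_Gt (hx i) (hy i))
    (fun i => hS.hasFDerivAt_G (hx i) (hy i)) j

theorem Assumptions.isClosed_feasible (hD : D.Assumptions) : IsClosed D.toNLP.feasible :=
  D.toNLP.isClosed_feasible hD.isClosed_X
    (fun j _ hx => (hD.hasFDerivAt_toNLP_g hx j).continuousAt.continuousWithinAt)
    (fun l _ _ => (D.hasFDerivAt_coupling _ l).continuousAt.continuousWithinAt)

theorem ApproxAssumptions.isClosed_feasible (hS : D.ApproxAssumptions S) (hD : D.Assumptions)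
    {y : BlockVec n} (hy : y ∈ D.toNLP.X) : IsClosed (D.approxNLP S y).feasible :=
  (D.approxNLP S y).isClosed_feasible hD.isClosed_X
    (fun j _ hx => (hS.hasFDerivAt_approxNLP_g hx hy j).continuousAt.continuousWithinAt)
    (fun l _ _ => (D.hasFDerivAt_coupling _ l).continuousAt.continuousWithinAt)

theorem ApproxAssumptions.approxNLP_g_self (hS : D.ApproxAssumptions S) {y : BlockVec n}
    (hy : y ∈ D.toNLP.X) (j : Fin rt ⊕ (Σ i, Fin (r i))) :
    (D.approxNLP S y).g j y = D.toNLP.g j y := by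
  rcases j with j | ⟨i, j⟩
  · exact Finset.sum_congr (s₁ := Finset.univ) rfl fun i _ => congrFun ((hS.coupling i).eq_self _ (hy i)) j
  · exact congrFun ((hS.block i).eq_self _ (hy i)) j

theorem ApproxAssumptions.toNLP_g_le (hS : D.ApproxAssumptions S) {x y : BlockVec n}
    (hx : x ∈ D.toNLP.X) (hy : y ∈ D.toNLP.X) (j : Fin rt ⊕ (Σ i, Fin (r i))) :
    D.toNLP.g j x ≤ (D.approxNLP S y).g j x := by
  rcases j with j | ⟨i, j⟩
  · exact Finset.sum_le_sum (s := Finset.univ) fun i _ => (hS.coupling i).upper _ (hx i) _ (hy i) j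
  · exact (hS.block i).upper _ (hx i) _ (hy i) j

theorem ApproxAssumptions.self_mem_feasible (hS : D.ApproxAssumptions S) {y : BlockVec n}
    (hy : y ∈ D.toNLP.feasible) : y ∈ (D.approxNLP S y).feasible :=
  ⟨hy.1, fun j => (hS.approxNLP_g_self hy.1 j).trans_le (hy.2.1 j), hy.2.2⟩

theorem ApproxAssumptions.convexOn_approxNLP_g (hS : D.ApproxAssumptions S) (hD : D.Assumptions)
    {y : BlockVec n} (hy : y ∈ D.toNLP.X) (j : Fin rt ⊕ (Σ i, Fin (r i))) :
    ConvexOn ℝ D.toNLP.X ((D.approxNLP S y).g j) := by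
  refine ⟨hD.convex_X, fun x hx z hz a b ha hb hab => ?_⟩
  rcases j with j | ⟨i, j⟩
  · simp only [approxNLP, Sum.elim_inl, smul_eq_mul, Finset.mul_sum, ← Finset.sum_add_distrib]
    exact Finset.sum_le_sum fun i _ =>
      ((hS.coupling i).convex _ (hy i) j).2 (hx i) (hz i) ha hb hab
  · exact ((hS.block i).convex _ (hy i) j).2 (hx i) (hz i) ha hb hab

/-! ### Strong convexity -/

theorem ApproxAssumptions.exists_modulus (hS : D.ApproxAssumptions S) (hD : D.Assumptions) :
    ∃ c : ℝ, 0 < c ∧ ∀ i, ∀ y ∈ D.X i, ∀ x ∈ D.X i, ∀ z ∈ D.X i,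
      S.F i x y + fderiv ℝ (fun w => S.F i w y) x (z - x) + c * ‖z - x‖ ^ 2 ≤ S.F i z y := by
  choose c hc hmono using fun i => (hS.objective i).stronglyConvex
  -- Working with small positive `d` instead of a minimum of the `c i` also covers the case of no
  -- blocks.
  have h : ∀ᶠ d : ℝ in 𝓝[>] 0, ∀ i, d ≤ c i / 2 :=
    eventually_all.2 fun i => by
      filter_upwards [Ioc_mem_nhdsGT (half_pos (hc i))] with d hd using hd.2
  obtain ⟨d, hd, hd0⟩ := (h.and self_mem_nhdsWithin).exists
  refine ⟨d, hd0, fun i y hy x hx z hz => ?_⟩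
  have h1 := quadratic_tangent_le (hD.convex i) (φ := fun w => S.F i w y)
    (φ' := fun x => fderiv ℝ (fun w => S.F i w y) x) (c := c i)
    (fun x hx => hS.hasFDerivAt_F hD hx hy) (fun x hx z hz => hmono i x hx z hz y hy) hx hz
  have h2 : d * ‖z - x‖ ^ 2 ≤ c i / 2 * ‖z - x‖ ^ 2 :=
    mul_le_mul_of_nonneg_right (hd i) (sq_nonneg _)
  linarith

/-- `c` is a modulus of strong convexity, shared by all blocks, of the approximate objectives. -/
def IsModulus (D : SDDProblem n r rt m) (S : SDDApprox n r rt) (c : ℝ) : Prop :=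
  0 < c ∧ ∀ i, ∀ y ∈ D.X i, ∀ x ∈ D.X i, ∀ z ∈ D.X i,
      S.F i x y + fderiv ℝ (fun w => S.F i w y) x (z - x) + c * ‖z - x‖ ^ 2 ≤ S.F i z y

/-- Derivative of the Lagrangian of a block. -/
def blockLagrangianDeriv (D : SDDProblem n r rt m) (S : SDDApprox n r rt) (i : Fin I)
    (y : EuclideanSpace ℝ (Fin (n i))) (mu : Fin rt → ℝ) (lam : Fin m → ℝ)
    (x : EuclideanSpace ℝ (Fin (n i))) : EuclideanSpace ℝ (Fin (n i)) →L[ℝ] ℝ :=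
  fderiv ℝ (fun z => S.F i z y) x
    + ∑ j, mu j • (ContinuousLinearMap.proj j).comp (fderiv ℝ (fun z => S.Gt i z y) x)
    + ∑ l, lam l • ∑ k, D.A i l k • EuclideanSpace.proj k

theorem ApproxAssumptions.hasFDerivAt_blockLagrangian (hS : D.ApproxAssumptions S)
    (hD : D.Assumptions) {i : Fin I} {x y : EuclideanSpace ℝ (Fin (n i))} (hx : x ∈ D.X i)
    (hy : y ∈ D.X i) (mu : Fin rt → ℝ) (lam : Fin m → ℝ) :
    HasFDerivAt (D.blockLagrangian S i y mu lam) (D.blockLagrangianDeriv S i y mu lam x) x := by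
  refine ((hS.hasFDerivAt_F hD hx hy).add ?_).add ?_
  · simp only [dotProduct]
    refine HasFDerivAt.fun_sum fun j _ => HasFDerivAt.const_mul ?_ _
    exact hasFDerivAt_pi'.1 (hS.hasFDerivAt_Gt hx hy) j
  · simp only [dotProduct, Matrix.mulVec]
    refine HasFDerivAt.fun_sum fun l _ => HasFDerivAt.const_mul ?_ _
    refine HasFDerivAt.fun_sum fun k _ => HasFDerivAt.const_mul ?_ _
    exact (EuclideanSpace.proj (𝕜 := ℝ) k).hasFDerivAt

/-- The quadratic term comes from `F`. Nonnegative multipliers preserve the tangent inequalities of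
`Gt`, and the term in `lam` is linear, so its sign is irrelevant. -/
theorem IsModulus.blockLagrangian_le {c : ℝ} (hc : IsModulus D S c) (hS : D.ApproxAssumptions S)
    {i : Fin I} {x y z : EuclideanSpace ℝ (Fin (n i))} (hx : x ∈ D.X i)
    (hy : y ∈ D.X i) (hz : z ∈ D.X i) {mu : Fin rt → ℝ} (hmu : ∀ j, 0 ≤ mu j)
    (lam : Fin m → ℝ) :
    D.blockLagrangian S i y mu lam x + D.blockLagrangianDeriv S i y mu lam x (z - x)
      + c * ‖z - x‖ ^ 2 ≤ D.blockLagrangian S i y mu lam z := by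
  have h1 := hc.2 i y hy x hx z hz
  have h2 : mu ⬝ᵥ S.Gt i x y
      + (∑ j, mu j • (ContinuousLinearMap.proj j).comp (fderiv ℝ (fun z => S.Gt i z y) x)) (z - x)
      ≤ mu ⬝ᵥ S.Gt i z y := by
    simp only [dotProduct, _root_.sum_apply, _root_.smul_apply,
      smul_eq_mul, ← Finset.sum_add_distrib, ← mul_add]
    refine Finset.sum_le_sum fun j _ => mul_le_mul_of_nonneg_left ?_ (hmu j)
    exact ((hS.coupling i).convex y hy j).tangent_le hx hz
      (hasFDerivAt_pi'.1 (hS.hasFDerivAt_Gt hx hy) j)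
  have h3 : lam ⬝ᵥ (D.A i *ᵥ x.ofLp)
      + (∑ l, lam l • ∑ k, D.A i l k • EuclideanSpace.proj (𝕜 := ℝ) k) (z - x)
      = lam ⬝ᵥ (D.A i *ᵥ z.ofLp) := by
    simp only [dotProduct, Matrix.mulVec, _root_.sum_apply,
      _root_.smul_apply, smul_eq_mul, ← Finset.sum_add_distrib, ← mul_add,
      PiLp.proj_apply, PiLp.sub_apply, add_sub_cancel]
  simp only [blockLagrangian, blockLagrangianDeriv, _root_.add_apply]
  linarith

theorem ApproxAssumptions.continuousOn_blockLagrangian (hS : D.ApproxAssumptions S)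
    (hD : D.Assumptions) {i : Fin I} {y : EuclideanSpace ℝ (Fin (n i))} (hy : y ∈ D.X i)
    (mu : Fin rt → ℝ) (lam : Fin m → ℝ) :
    ContinuousOn (D.blockLagrangian S i y mu lam) (D.X i) :=
  fun _ hx => (hS.hasFDerivAt_blockLagrangian hD hx hy mu lam).continuousAt.continuousWithinAt

/-- The feasible set of the `i`-th subproblem. -/
def subFeasible (D : SDDProblem n r rt m) (S : SDDApprox n r rt) (i : Fin I)
    (y : EuclideanSpace ℝ (Fin (n i))) : Set (EuclideanSpace ℝ (Fin (n i))) :=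
  {x | x ∈ D.X i ∧ ∀ j, S.G i x y j ≤ 0}

theorem ApproxAssumptions.convex_subFeasible (hS : D.ApproxAssumptions S)
    {i : Fin I} {y : EuclideanSpace ℝ (Fin (n i))} (hy : y ∈ D.X i) (hD : D.Assumptions) :
    Convex ℝ (D.subFeasible S i y) := by
  intro x hx z hz a b ha hb hab
  refine ⟨hD.convex i hx.1 hz.1 ha hb hab, fun j => ?_⟩
  have := ((hS.block i).convex y hy j).2 hx.1 hz.1 ha hb hab
  simp only [smul_eq_mul] at this
  nlinarith [mul_nonneg ha (neg_nonneg.2 (hx.2 j)), mul_nonneg hb (neg_nonneg.2 (hz.2 j))]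

theorem ApproxAssumptions.isClosed_subFeasible (hS : D.ApproxAssumptions S) (hD : D.Assumptions)
    {i : Fin I} {y : EuclideanSpace ℝ (Fin (n i))} (hy : y ∈ D.X i) :
    IsClosed (D.subFeasible S i y) := by
  have h := NLP.isClosed_feasible (κ := Empty)
    ⟨fun _ => 0, fun j x => S.G i x y j, fun _ _ => 0, D.X i⟩ (hD.isClosed i)
    (fun j x hx => (hasFDerivAt_pi'.1 (hS.hasFDerivAt_G hx hy) j).continuousAt.continuousWithinAt)
    (fun l => l.elim)
  convert h using 1
  ext x
  simp [NLP.feasible, subFeasible]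

/-- First-order optimality of `u` on the convex set `subFeasible` removes the linear term of the
tangent inequality. -/
theorem IsSubOptimal.quadratic_growth {c : ℝ} (hc : IsModulus D S c)
    (hS : D.ApproxAssumptions S) (hD : D.Assumptions) {i : Fin I}
    {u y z : EuclideanSpace ℝ (Fin (n i))} (hy : y ∈ D.X i) {mu : Fin rt → ℝ}
    (hmu : ∀ j, 0 ≤ mu j) {lam : Fin m → ℝ} (hu : D.IsSubOptimal S i y mu lam u)
    (hz : z ∈ D.subFeasible S i y) :
    D.blockLagrangian S i y mu lam u + c * ‖z - u‖ ^ 2 ≤ D.blockLagrangian S i y mu lam z := by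
  have h1 := hc.blockLagrangian_le hS hu.1.1 hy hz.1 hmu lam
  have h2 := IsMinOn.fderiv_sub_nonneg (hS.convex_subFeasible hy hD) (x := u) (z := z)
    (fun w hw => hu.2 w hw.1 hw.2) hu.1 hz (hS.hasFDerivAt_blockLagrangian hD hu.1.1 hy mu lam)
  linarith

theorem existsUnique_isSubOptimal (hD : D.Assumptions) (hS : D.ApproxAssumptions S)
    {y : BlockVec n} (hy : y ∈ D.toNLP.feasible) {mu : Fin rt → ℝ} (lam : Fin m → ℝ)
    (hmu : ∀ j, 0 ≤ mu j) (i : Fin I) : ∃! x, D.IsSubOptimal S i (y i) mu lam x := by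
  obtain ⟨c, hc⟩ : ∃ c, IsModulus D S c := hS.exists_modulus hD
  have hyi := hy.1 i
  have hyS : y i ∈ D.subFeasible S i (y i) :=
    ⟨hyi, fun j => (hS.self_mem_feasible hy).2.1 (Sum.inr ⟨i, j⟩)⟩
  -- The base point `y i` is feasible for its own subproblem; the growth is the tangent inequality
  -- there.
  obtain ⟨x, hx, hmin⟩ := exists_isMinOn_of_quadratic_growth (hS.isClosed_subFeasible hD hyi)
    ((hS.continuousOn_blockLagrangian hD hyi mu lam).mono fun x hx => hx.1) hyS
    (b := ‖D.blockLagrangianDeriv S i (y i) mu lam (y i)‖) hc.1 fun x hx => by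
      have h1 := hc.blockLagrangian_le hS hyi hyi hx.1 hmu lam
      have h2 := (abs_le.1 ((D.blockLagrangianDeriv S i (y i) mu lam (y i)).le_opNorm
        (x - y i))).1
      linarith
  refine ⟨x, ⟨hx, fun z hz hz' => hmin ⟨hz, hz'⟩⟩, fun z hz => ?_⟩
  have h1 := hz.quadratic_growth hc hS hD hyi hmu hx
  have h2 := hmin hz.1
  simp only [Set.mem_ofPred_eq] at h2
  have h3 : ‖x - z‖ ^ 2 ≤ 0 := by nlinarith [hc.1]
  have h4 : ‖x - z‖ = 0 := by nlinarith [norm_nonneg (x - z)]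
  exact (sub_eq_zero.1 (norm_eq_zero.1 h4)).symm

end SDDProblem

end Blocks

/-! ### Saddle points of the approximate problem and the inner loop. -/

section Inner

variable {I : ℕ} {n r : Fin I → ℕ} {rt m : ℕ}

namespace SDDProblem

variable {D : SDDProblem n r rt m} {S : SDDApprox n r rt}

/-- The block Lagrangians omit the constant `lam ⬝ᵥ D.b`; it cancels whenever two sums with the same
`lam` are compared. -/
theorem sum_blockLagrangian (D : SDDProblem n r rt m) (S : SDDApprox n r rt) (y x : BlockVec n)
    (mu : Fin rt → ℝ) (lam : Fin m → ℝ) :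
    ∑ i, D.blockLagrangian S i (y i) mu lam (x i) = (D.approxNLP S y).f x
      + mu ⬝ᵥ D.dualGradMu S y x + lam ⬝ᵥ D.dualGradLam x - lam ⬝ᵥ D.b := by
  simp only [blockLagrangian, Finset.sum_add_distrib, dualGradMu, dualGradLam,
    dotProduct_coupling, dotProduct_sum, approxNLP]
  ring

theorem approxNLP_g_inl (D : SDDProblem n r rt m) (S : SDDApprox n r rt) (y x : BlockVec n)
    (j : Fin rt) : (D.approxNLP S y).g (Sum.inl j) x = D.dualGradMu S y x j := by
  simp [approxNLP, dualGradMu, Finset.sum_apply]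

/-! ### The convex approximate problem -/

theorem IsModulus.approxNLP_f_le {c : ℝ} (hc : IsModulus D S c) {x y z : BlockVec n}
    (hx : x ∈ D.toNLP.X) (hy : y ∈ D.toNLP.X) (hz : z ∈ D.toNLP.X) :
    (D.approxNLP S y).f x
      + (blockSum fun i => fderiv ℝ (fun w => S.F i w (y i)) (x i)) (z - x)
      + c * ∑ i, ‖z i - x i‖ ^ 2 ≤ (D.approxNLP S y).f z := by
  rw [blockSum_apply, Finset.mul_sum]
  simp only [approxNLP, ← Finset.sum_add_distrib]
  exact Finset.sum_le_sum fun i _ => hc.2 i _ (hy i) _ (hx i) _ (hz i)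

theorem exists_isOptimal_approxNLP (hD : D.Assumptions) (hS : D.ApproxAssumptions S)
    {y : BlockVec n} (hy : y ∈ D.toNLP.feasible) : ∃ x, (D.approxNLP S y).IsOptimal x := by
  obtain ⟨c, hc⟩ : ∃ c, IsModulus D S c := hS.exists_modulus hD
  obtain ⟨x, hx, hmin⟩ := exists_isMinOn_of_quadratic_growth (hS.isClosed_feasible hD hy.1)
    (φ := (D.approxNLP S y).f)
    (fun x hx => (hS.hasFDerivAt_approxNLP_f hD hx.1 hy.1).continuousAt.continuousWithinAt)
    (hS.self_mem_feasible hy)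
    (b := ‖blockSum fun i => fderiv ℝ (fun w => S.F i w (y i)) (y i)‖) hc.1 fun x hx => by
      have h1 := hc.approxNLP_f_le hy.1 hy.1 hx.1
      have h2 := (abs_le.1 ((blockSum fun i =>
        fderiv ℝ (fun w => S.F i w (y i)) (y i)).le_opNorm (x - y))).1
      have h3 := mul_le_mul_of_nonneg_left (sq_norm_le_sum_sq_norm (x - y)) hc.1.le
      simp only [Pi.sub_apply] at h3
      linarith
  exact ⟨x, hx, hmin⟩

/-- Fritz John multipliers at an optimal point of the convex approximate problem. -/
theorem exists_fritzJohn_approxNLP (hD : D.Assumptions) (hS : D.ApproxAssumptions S)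
    {x y : BlockVec n} (hy : y ∈ D.toNLP.X) (hx : (D.approxNLP S y).IsOptimal x) :
    ∃ (α : ℝ) (mu : Fin rt ⊕ (Σ i, Fin (r i)) → ℝ) (lam : Fin m → ℝ), (α, mu, lam) ≠ 0 ∧ 0 ≤ α ∧
      (∀ j, 0 ≤ mu j) ∧ (∀ j, mu j * (D.approxNLP S y).g j x = 0) ∧
      ∀ z ∈ D.toNLP.X, α * (D.approxNLP S y).f x ≤ α * (D.approxNLP S y).f z
        + ∑ j, mu j * (D.approxNLP S y).g j z + ∑ l, lam l * D.coupling z l := by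
  obtain ⟨c, hc⟩ : ∃ c, IsModulus D S c := hS.exists_modulus hD
  refine ConvexOn.exists_fritzJohn (h := fun l z => D.coupling z l)
    (convexOn_of_tangent_le hD.convex_X
      (φ' := fun x => blockSum fun i => fderiv ℝ (fun w => S.F i w (y i)) (x i)) ?_)
    (hS.convexOn_approxNLP_g hD hy) D.coupling_affine hx.1.1 hx.1.2.1 hx.1.2.2
    fun z hz h1 h2 => hx.2 z ⟨hz, h1, h2⟩
  intro x hx z hz
  have h1 := hc.approxNLP_f_le hx hy hz
  have h2 : 0 ≤ c * ∑ i, ‖z i - x i‖ ^ 2 :=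
    mul_nonneg hc.1.le (Finset.sum_nonneg fun i _ => sq_nonneg _)
  linarith

/-- Derivative of `α f + muᵀ g + lamᵀ h` for the approximate problem at `y`. -/
def fritzJohnDeriv (D : SDDProblem n r rt m) (S : SDDApprox n r rt) (y x : BlockVec n) (α : ℝ)
    (mu : Fin rt ⊕ (Σ i, Fin (r i)) → ℝ) (lam : Fin m → ℝ) : BlockVec n →L[ℝ] ℝ :=
  α • blockSum (fun i => fderiv ℝ (fun z => S.F i z (y i)) (x i))
    + ∑ j, mu j • blockConstraintDeriv (fun i => fderiv ℝ (fun z => S.Gt i z (y i)) (x i))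
        (fun i => fderiv ℝ (fun z => S.G i z (y i)) (x i)) j
    + ∑ l, lam l • D.couplingLin l

theorem ApproxAssumptions.hasFDerivAt_fritzJohn (hS : D.ApproxAssumptions S) (hD : D.Assumptions)
    {x y : BlockVec n} (hx : x ∈ D.toNLP.X) (hy : y ∈ D.toNLP.X) (α : ℝ)
    (mu : Fin rt ⊕ (Σ i, Fin (r i)) → ℝ) (lam : Fin m → ℝ) :
    HasFDerivAt (fun z => α * (D.approxNLP S y).f z + ∑ j, mu j * (D.approxNLP S y).g j z
      + ∑ l, lam l * D.coupling z l) (D.fritzJohnDeriv S y x α mu lam) x := by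
  refine (((hS.hasFDerivAt_approxNLP_f hD hx hy).const_mul α).add ?_).add ?_
  · exact HasFDerivAt.fun_sum fun j _ => (hS.hasFDerivAt_approxNLP_g hx hy j).const_mul _
  · exact HasFDerivAt.fun_sum fun l _ => (D.hasFDerivAt_coupling x l).const_mul _

/-- First-order consistency at the point of approximation: this is how conditions on the approximate
problem become conditions on the original one. -/
theorem fritzJohnDeriv_self (hD : D.Assumptions) (hS : D.ApproxAssumptions S) {y : BlockVec n}
    (hy : y ∈ D.toNLP.X) (α : ℝ) (mu : Fin rt ⊕ (Σ i, Fin (r i)) → ℝ) (lam : Fin m → ℝ) :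
    D.fritzJohnDeriv S y y α mu lam = α • fderiv ℝ D.toNLP.f y
      + ∑ j, mu j • fderiv ℝ (D.toNLP.g j) y + ∑ l, lam l • fderiv ℝ (D.toNLP.h l) y := by
  have h1 : fderiv ℝ D.toNLP.f y = _ := (hD.hasFDerivAt_toNLP_f hy).fderiv
  have h2 : ∀ j, fderiv ℝ (D.toNLP.g j) y = _ := fun j => (hD.hasFDerivAt_toNLP_g hy j).fderiv
  have h3 : ∀ l, fderiv ℝ (D.toNLP.h l) y = D.couplingLin l := fun l =>
    (D.hasFDerivAt_coupling y l).fderiv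
  have e1 : ∀ i, fderiv ℝ (fun z => S.F i z (y i)) (y i) = fderiv ℝ (D.f i) (y i) :=
    fun i => (hS.objective i).grad_eq _ (hy i)
  have e2 : ∀ i, fderiv ℝ (fun z => S.Gt i z (y i)) (y i) = fderiv ℝ (D.gt i) (y i) :=
    fun i => (hS.coupling i).grad_eq _ (hy i)
  have e3 : ∀ i, fderiv ℝ (fun z => S.G i z (y i)) (y i) = fderiv ℝ (D.g i) (y i) :=
    fun i => (hS.block i).grad_eq _ (hy i)
  simp only [fritzJohnDeriv, h1, h2, h3, e1, e2, e3]

/-- MFCQ read as the absence of nonzero Fritz John multipliers with objective weight 0. -/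
theorem eq_zero_of_isRegular (hD : D.Assumptions) (hS : D.ApproxAssumptions S) {y : BlockVec n}
    (hy : D.toNLP.IsRegular y) {mu : Fin rt ⊕ (Σ i, Fin (r i)) → ℝ} {lam : Fin m → ℝ}
    (hmu : ∀ j, 0 ≤ mu j) (hcomp : ∀ j, mu j * D.toNLP.g j y = 0)
    (h : ∀ z ∈ D.toNLP.X, 0 ≤ D.fritzJohnDeriv S y y 0 mu lam (z - y)) : mu = 0 ∧ lam = 0 := by
  refine hy.2 mu lam (fun z hz => ?_) hmu fun j hj => (mul_eq_zero.1 (hcomp j)).resolve_right hj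
  have := h z hz
  rwa [fritzJohnDeriv_self hD hS hy.1.1, zero_smul, zero_add] at this

/-- `x` is primal optimal and `(mu, lam)` is dual optimal for the convex approximate problem. -/
structure IsSaddle (D : SDDProblem n r rt m) (S : SDDApprox n r rt) (y x : BlockVec n)
    (mu : Fin rt → ℝ) (lam : Fin m → ℝ) : Prop where
  nonneg : ∀ j, 0 ≤ mu j
  feasible : x ∈ (D.approxNLP S y).feasible
  complementarity : mu ⬝ᵥ D.dualGradMu S y x = 0
  sub : ∀ i, D.IsSubOptimal S i (y i) mu lam (x i)

theorem mem_subFeasible_of_mem_feasible {x y : BlockVec n}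
    (hx : x ∈ (D.approxNLP S y).feasible) (i : Fin I) : x i ∈ D.subFeasible S i (y i) :=
  ⟨hx.1 i, fun j => hx.2.1 (Sum.inr ⟨i, j⟩)⟩

theorem dotProduct_dualGradMu_nonpos {x y : BlockVec n} (hx : x ∈ (D.approxNLP S y).feasible)
    {mu : Fin rt → ℝ} (hmu : ∀ j, 0 ≤ mu j) : mu ⬝ᵥ D.dualGradMu S y x ≤ 0 :=
  Finset.sum_nonpos fun j _ => mul_nonpos_of_nonneg_of_nonpos (hmu j)
    (by simpa [approxNLP_g_inl] using hx.2.1 (Sum.inl j))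

theorem dualGradLam_eq_zero {x y : BlockVec n} (hx : x ∈ (D.approxNLP S y).feasible) :
    D.dualGradLam x = 0 :=
  funext hx.2.2

theorem sum_blockLagrangian_add_le {c : ℝ} (hc : IsModulus D S c) (hS : D.ApproxAssumptions S)
    (hD : D.Assumptions) {x y z : BlockVec n} (hy : y ∈ D.toNLP.X)
    {mu : Fin rt → ℝ} (hmu : ∀ j, 0 ≤ mu j) {lam : Fin m → ℝ}
    (hx : ∀ i, D.IsSubOptimal S i (y i) mu lam (x i)) (hz : ∀ i, z i ∈ D.subFeasible S i (y i)) :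
    ∑ i, D.blockLagrangian S i (y i) mu lam (x i) + c * ∑ i, ‖z i - x i‖ ^ 2
      ≤ ∑ i, D.blockLagrangian S i (y i) mu lam (z i) := by
  rw [Finset.mul_sum, ← Finset.sum_add_distrib]
  exact Finset.sum_le_sum fun i _ => (hx i).quadratic_growth hc hS hD (hy i) hmu (hz i)

theorem IsSaddle.approxNLP_f_add_le {c : ℝ} (hc : IsModulus D S c) (hS : D.ApproxAssumptions S)
    (hD : D.Assumptions) {x y z : BlockVec n} {mu : Fin rt → ℝ} {lam : Fin m → ℝ}
    (hy : y ∈ D.toNLP.X) (h : IsSaddle D S y x mu lam)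
    (hz : z ∈ (D.approxNLP S y).feasible) :
    (D.approxNLP S y).f x + c * ∑ i, ‖z i - x i‖ ^ 2 ≤ (D.approxNLP S y).f z := by
  have h1 := sum_blockLagrangian_add_le hc hS hD hy h.nonneg h.sub
    (mem_subFeasible_of_mem_feasible hz)
  rw [sum_blockLagrangian, sum_blockLagrangian, dualGradLam_eq_zero hz,
    dualGradLam_eq_zero h.feasible, h.complementarity] at h1
  linarith [dotProduct_dualGradMu_nonpos hz h.nonneg]

theorem IsSaddle.isUniqueOptimal (hD : D.Assumptions) (hS : D.ApproxAssumptions S)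
    {x y : BlockVec n} {mu : Fin rt → ℝ} {lam : Fin m → ℝ}
    (hy : y ∈ D.toNLP.X) (h : IsSaddle D S y x mu lam) :
    (D.approxNLP S y).IsUniqueOptimal x := by
  obtain ⟨c, hc⟩ : ∃ c, IsModulus D S c := hS.exists_modulus hD
  have hQ : ∀ z : BlockVec n, 0 ≤ ∑ i, ‖z i - x i‖ ^ 2 :=
    fun z => Finset.sum_nonneg fun i _ => sq_nonneg _
  refine ⟨⟨h.feasible, fun z hz => ?_⟩, fun z hz => ?_⟩
  · have := h.approxNLP_f_add_le hc hS hD hy hz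
    have := mul_nonneg hc.1.le (hQ z)
    linarith
  · have h1 := h.approxNLP_f_add_le hc hS hD hy hz.1
    have h2 := hz.2 x h.feasible
    have h3 : ∑ i, ‖z i - x i‖ ^ 2 ≤ 0 := by nlinarith [hc.1]
    have h4 := sq_norm_le_sum_sq_norm (z - x)
    simp only [Pi.sub_apply] at h4
    have h5 : ‖z - x‖ = 0 := by nlinarith [norm_nonneg (z - x)]
    exact sub_eq_zero.1 (norm_eq_zero.1 h5)

/-- Regularity is used at `y`, not at the optimal point `x`. If `α = 0`, the multiplier inequality
at the feasible point `y` forces complementarity there, so `y` minimizes the weighted constraints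
over `X`, and MFCQ makes all multipliers vanish. -/
theorem exists_isSaddle (hD : D.Assumptions) (hS : D.ApproxAssumptions S) {y : BlockVec n}
    (hy : D.toNLP.IsRegular y) : ∃ x mu lam, IsSaddle D S y x mu lam := by
  classical
  obtain ⟨x, hx⟩ := exists_isOptimal_approxNLP hD hS hy.1
  obtain ⟨α, mu, lam, hne, hα, hmu, hcomp, hmin⟩ := exists_fritzJohn_approxNLP hD hS hy.1.1 hx
  have hα0 : 0 < α := by
    refine hα.lt_of_ne' fun h0 => hne ?_
    subst h0
    have hyf := hS.self_mem_feasible hy.1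
    have hval := hmin y hy.1.1
    have hterm : ∀ j ∈ Finset.univ, mu j * (D.approxNLP S y).g j y ≤ 0 := fun j _ =>
      mul_nonpos_of_nonneg_of_nonpos (hmu j) (hyf.2.1 j)
    have hh : ∀ l, D.coupling y l = 0 := hyf.2.2
    simp only [zero_mul, zero_add, hh, mul_zero, Finset.sum_const_zero, add_zero] at hval
    have hsum := le_antisymm (Finset.sum_nonpos hterm) hval
    have hc : ∀ j, mu j * (D.approxNLP S y).g j y = 0 := fun j =>
      (Finset.sum_eq_zero_iff_of_nonpos hterm).1 hsum j (Finset.mem_univ j)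
    obtain ⟨h1, h2⟩ := eq_zero_of_isRegular hD hS hy (lam := lam) hmu
      (fun j => by rw [← hS.approxNLP_g_self hy.1.1]; exact hc j) fun z hz =>
        IsMinOn.fderiv_sub_nonneg hD.convex_X (fun w hw => by
          have := hmin w hw
          simpa [hh, hsum] using this) hy.1.1 hz (hS.hasFDerivAt_fritzJohn hD hy.1.1 hy.1.1 0 mu lam)
    rw [h1, h2]; rfl
  have hcomp' : (fun j => mu (Sum.inl j) / α) ⬝ᵥ D.dualGradMu S y x = 0 := by
    refine Finset.sum_eq_zero fun j _ => ?_
    have := hcomp (Sum.inl j)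
    rw [approxNLP_g_inl] at this
    rw [div_mul_eq_mul_div, this, zero_div]
  -- Only the coupling constraints are dualized. The multipliers of the block constraints are
  -- dropped, as their terms are nonpositive on the subproblems' feasible sets.
  have hmin' : ∀ z : BlockVec n, (∀ i, z i ∈ D.subFeasible S i (y i)) →
      ∑ i, D.blockLagrangian S i (y i) (fun j => mu (Sum.inl j) / α) (fun l => lam l / α) (x i)
      ≤ ∑ i, D.blockLagrangian S i (y i) (fun j => mu (Sum.inl j) / α) (fun l => lam l / α)
        (z i) := by
    intro z hz
    rw [sum_blockLagrangian, sum_blockLagrangian, hcomp', dualGradLam_eq_zero hx.1,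
      dotProduct_zero]
    have h1 := hmin z fun i => (hz i).1
    rw [Fintype.sum_sum_type] at h1
    have h2 : ∑ s : Σ i, Fin (r i), mu (Sum.inr s) * (D.approxNLP S y).g (Sum.inr s) z ≤ 0 :=
      Finset.sum_nonpos fun s _ => mul_nonpos_of_nonneg_of_nonpos (hmu _) ((hz s.1).2 s.2)
    have h3 : α * ((fun j => mu (Sum.inl j) / α) ⬝ᵥ D.dualGradMu S y z)
        = ∑ j, mu (Sum.inl j) * (D.approxNLP S y).g (Sum.inl j) z := by
      rw [dotProduct, Finset.mul_sum]
      refine Finset.sum_congr rfl fun j _ => ?_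
      rw [approxNLP_g_inl]
      field_simp
    have h4 : α * ((fun l => lam l / α) ⬝ᵥ D.dualGradLam z)
        = ∑ l, lam l * D.coupling z l := by
      rw [dotProduct, Finset.mul_sum]
      refine Finset.sum_congr rfl fun j _ => ?_
      rw [dualGradLam]
      field_simp
    have h5 : (D.approxNLP S y).f x ≤ (D.approxNLP S y).f z
        + (fun j => mu (Sum.inl j) / α) ⬝ᵥ D.dualGradMu S y z
        + (fun l => lam l / α) ⬝ᵥ D.dualGradLam z := by
      refine le_of_mul_le_mul_left ?_ hα0
      rw [mul_add, mul_add, h3, h4]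
      linarith
    linarith
  refine ⟨x, _, fun l => lam l / α, fun j => div_nonneg (hmu _) hα0.le, hx.1, hcomp', fun i =>
    ⟨mem_subFeasible_of_mem_feasible hx.1 i, fun w hw hw' => ?_⟩⟩
  -- Changing a single block turns joint minimality into minimality for that block.
  have h1 := hmin' (Function.update x i w) fun k => by
    rcases eq_or_ne k i with rfl | hk
    · simpa using ⟨hw, hw'⟩
    · simpa [hk] using mem_subFeasible_of_mem_feasible hx.1 k
  rw [← Finset.add_sum_erase _ _ (Finset.mem_univ i),
    ← Finset.add_sum_erase _ _ (Finset.mem_univ i), Function.update_self] at h1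
  have h2 : ∑ k ∈ Finset.univ.erase i, D.blockLagrangian S k (y k)
      (fun j => mu (Sum.inl j) / α) (fun l => lam l / α) (Function.update x i w k)
      = ∑ k ∈ Finset.univ.erase i, D.blockLagrangian S k (y k)
      (fun j => mu (Sum.inl j) / α) (fun l => lam l / α) (x k) :=
    Finset.sum_congr rfl fun k hk => by rw [Function.update_of_ne (Finset.ne_of_mem_erase hk)]
  linarith

/-! ### Convergence of the inner loop -/

namespace IsInnerRun

variable {y : BlockVec n} {mu : ℕ → Fin rt → ℝ} {lam : ℕ → Fin m → ℝ} {u : ℕ → BlockVec n}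
  {γin : ℕ → ℝ}

theorem mu_nonneg (hrun : D.IsInnerRun S y mu lam u γin) (t : ℕ) (j : Fin rt) : 0 ≤ mu t j := by
  cases t with
  | zero => exact hrun.init j
  | succ t => rw [hrun.mu_step]; exact le_max_right _ _

/-- Add two growth inequalities: `u t` minimizes the Lagrangian at `(mu t, lam t)` and is compared
with `x`, while `x` minimizes it at `(mu₀, lam₀)` and is compared with `u t`. The objectives cancel,
and each inequality contributes one `c`. -/
theorem dotProduct_add_le {c : ℝ} (hrun : D.IsInnerRun S y mu lam u γin)
    (hc : IsModulus D S c) (hS : D.ApproxAssumptions S) (hD : D.Assumptions)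
    (hy : y ∈ D.toNLP.X) {x : BlockVec n} {mu₀ : Fin rt → ℝ} {lam₀ : Fin m → ℝ}
    (h : IsSaddle D S y x mu₀ lam₀) (t : ℕ) :
    (mu t - mu₀) ⬝ᵥ D.dualGradMu S y (u t) + (lam t - lam₀) ⬝ᵥ D.dualGradLam (u t)
      + 2 * c * ∑ i, ‖u t i - x i‖ ^ 2 ≤ 0 := by
  have h1 := sum_blockLagrangian_add_le hc hS hD hy (hrun.mu_nonneg t) (hrun.sub t)
    (mem_subFeasible_of_mem_feasible h.feasible)
  have h2 := sum_blockLagrangian_add_le hc hS hD hy h.nonneg h.sub (fun i => (hrun.sub t i).1)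
  rw [sum_blockLagrangian, sum_blockLagrangian, dualGradLam_eq_zero h.feasible,
    dotProduct_zero] at h1 h2
  rw [h.complementarity] at h2
  have h3 := dotProduct_dualGradMu_nonpos h.feasible (hrun.mu_nonneg t)
  simp only [fun i => norm_sub_rev (x i) (u t i)] at h1
  rw [sub_dotProduct, sub_dotProduct]
  linarith

/-- Squared distance of the dual iterates to a dual point. -/
theorem sq_dist_step (hrun : D.IsInnerRun S y mu lam u γin) {C : ℝ}
    (hC : ∀ t, ‖D.dualGradMu S y (u t)‖ ≤ C ∧ ‖D.dualGradLam (u t)‖ ≤ C)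
    {mu₀ : Fin rt → ℝ} (hmu₀ : ∀ j, 0 ≤ mu₀ j) (lam₀ : Fin m → ℝ) (t : ℕ) :
    (∑ j, (mu (t + 1) j - mu₀ j) ^ 2 + ∑ l, (lam (t + 1) l - lam₀ l) ^ 2)
      + γin t * -(2 * ((mu t - mu₀) ⬝ᵥ D.dualGradMu S y (u t)
        + (lam t - lam₀) ⬝ᵥ D.dualGradLam (u t)))
    ≤ (∑ j, (mu t j - mu₀ j) ^ 2 + ∑ l, (lam t l - lam₀ l) ^ 2)
      + γin t ^ 2 * ((rt + m) * C ^ 2) := by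
  have hb : ∀ {k : ℕ} (v : Fin k → ℝ), ‖v‖ ≤ C → ∀ j, v j ^ 2 ≤ C ^ 2 := fun v hv j => by
    rw [← sq_abs]
    have := (norm_le_pi_norm v j).trans hv
    rw [Real.norm_eq_abs] at this
    gcongr
  have h1 : ∑ j, (mu (t + 1) j - mu₀ j) ^ 2 ≤ ∑ j, (mu t j - mu₀ j) ^ 2
      + 2 * γin t * ((mu t - mu₀) ⬝ᵥ D.dualGradMu S y (u t)) + γin t ^ 2 * (rt * C ^ 2) := by
    have : γin t ^ 2 * (rt * C ^ 2) = ∑ j : Fin rt, γin t ^ 2 * C ^ 2 := by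
      simp; ring
    rw [this, dotProduct, Finset.mul_sum, ← Finset.sum_add_distrib, ← Finset.sum_add_distrib]
    refine Finset.sum_le_sum fun j _ => ?_
    have h2 := mul_le_mul_of_nonneg_left (hb _ (hC t).1 j) (sq_nonneg (γin t))
    -- Clipping at 0 does not increase the distance to the nonnegative number `mu₀ j`.
    have h3 : (mu (t + 1) j - mu₀ j) ^ 2
        ≤ (mu t j + γin t * D.dualGradMu S y (u t) j - mu₀ j) ^ 2 := by
      rw [hrun.mu_step]
      rcases le_total (mu t j + γin t * D.dualGradMu S y (u t) j) 0 with h | h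
      · rw [max_eq_right h]
        nlinarith [hmu₀ j]
      · rw [max_eq_left h]
    simp only [Pi.sub_apply]
    nlinarith
  have h2 : ∑ l, (lam (t + 1) l - lam₀ l) ^ 2 ≤ ∑ l, (lam t l - lam₀ l) ^ 2
      + 2 * γin t * ((lam t - lam₀) ⬝ᵥ D.dualGradLam (u t)) + γin t ^ 2 * (m * C ^ 2) := by
    have : γin t ^ 2 * (m * C ^ 2) = ∑ j : Fin m, γin t ^ 2 * C ^ 2 := by
      simp; ring
    rw [this, dotProduct, Finset.mul_sum, ← Finset.sum_add_distrib, ← Finset.sum_add_distrib]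
    refine Finset.sum_le_sum fun j _ => ?_
    have h2 := mul_le_mul_of_nonneg_left (hb _ (hC t).2 j) (sq_nonneg (γin t))
    rw [hrun.lam_step]
    simp only [Pi.sub_apply, Pi.add_apply, Pi.smul_apply, smul_eq_mul]
    nlinarith
  linarith

theorem mem_X (hrun : D.IsInnerRun S y mu lam u γin) (t : ℕ) : u t ∈ D.toNLP.X :=
  fun i => (hrun.sub t i).1.1

/-- A limit of dual iterates along a subsequence whose primal iterates converge. -/
theorem isSaddle_of_tendsto (hrun : D.IsInnerRun S y mu lam u γin)
    (hS : D.ApproxAssumptions S) (hD : D.Assumptions)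
    (hy : y ∈ D.toNLP.X) {x : BlockVec n} {mu₀ mu₁ : Fin rt → ℝ} {lam₀ lam₁ : Fin m → ℝ}
    (h : IsSaddle D S y x mu₀ lam₀) {φ : ℕ → ℕ} (hu : Tendsto (u ∘ φ) atTop (𝓝 x))
    (hmu : Tendsto (mu ∘ φ) atTop (𝓝 mu₁)) (hlam : Tendsto (lam ∘ φ) atTop (𝓝 lam₁))
    (hs : Tendsto (fun k => (mu (φ k) - mu₀) ⬝ᵥ D.dualGradMu S y (u (φ k))
      + (lam (φ k) - lam₀) ⬝ᵥ D.dualGradLam (u (φ k))) atTop (𝓝 0)) :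
    IsSaddle D S y x mu₁ lam₁ := by
  have hGt : ∀ i, Tendsto (fun k => S.Gt i (u (φ k) i) (y i)) atTop (𝓝 (S.Gt i (x i) (y i))) :=
    fun i => (hS.hasFDerivAt_Gt (h.feasible.1 i) (hy i)).continuousAt.tendsto.comp
      (tendsto_pi_nhds.1 hu i)
  have hF : ∀ i, Tendsto (fun k => S.F i (u (φ k) i) (y i)) atTop (𝓝 (S.F i (x i) (y i))) :=
    fun i => (hS.hasFDerivAt_F hD (h.feasible.1 i) (hy i)).continuousAt.tendsto.comp
      (tendsto_pi_nhds.1 hu i)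
  have hdot : ∀ {k : ℕ} {v w : ℕ → Fin k → ℝ} {v₀ w₀ : Fin k → ℝ}, Tendsto v atTop (𝓝 v₀) →
      Tendsto w atTop (𝓝 w₀) → Tendsto (fun t => v t ⬝ᵥ w t) atTop (𝓝 (v₀ ⬝ᵥ w₀)) :=
    fun hv hw => tendsto_finsetSum _ fun j _ =>
      (tendsto_pi_nhds.1 hv j).mul (tendsto_pi_nhds.1 hw j)
  refine ⟨fun j => ge_of_tendsto' (tendsto_pi_nhds.1 hmu j) fun k => hrun.mu_nonneg _ j,
    h.feasible, ?_, fun i => ⟨mem_subFeasible_of_mem_feasible h.feasible i, fun z hz hz' => ?_⟩⟩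
  · have h1 : Tendsto (fun k => D.dualGradMu S y (u (φ k))) atTop (𝓝 (D.dualGradMu S y x)) :=
      tendsto_finsetSum _ fun i _ => hGt i
    have h2 : Tendsto (fun k => D.dualGradLam (u (φ k))) atTop (𝓝 (D.dualGradLam x)) :=
      (D.continuous_coupling.tendsto x).comp hu
    -- In the limit the equality residual and `mu₀ ⬝ᵥ D.dualGradMu S y x` vanish, so the vanishing
    -- gap leaves complementarity for `mu₁`.
    have h3 := (hdot (hmu.sub_const mu₀) h1).add (hdot (hlam.sub_const lam₀) h2)
    have h4 := tendsto_nhds_unique h3 hs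
    rw [dualGradLam_eq_zero h.feasible, dotProduct_zero, sub_dotProduct, h.complementarity] at h4
    linarith
  · have hA : Continuous fun w : EuclideanSpace ℝ (Fin (n i)) => D.A i *ᵥ w.ofLp := by
      refine continuous_pi fun l => ?_
      simp only [Matrix.mulVec, dotProduct]
      fun_prop
    refine le_of_tendsto_of_tendsto' (((hF i).add (hdot hmu (hGt i))).add
      (hdot hlam ((hA.tendsto (x i)).comp (tendsto_pi_nhds.1 hu i))))
      ((tendsto_const_nhds.add (hdot hmu tendsto_const_nhds)).add (hdot hlam tendsto_const_nhds))
      fun k => (hrun.sub (φ k) i).2 z hz hz'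

/-- An Opial-type argument: the distance to every dual solution converges, so one subsequential
limit that is itself a dual solution attracts the whole dual sequence. The bound `C` serves twice,
to make the errors summable and to pass from dual convergence to a vanishing gap. -/
theorem tendsto_of_bounded (hrun : D.IsInnerRun S y mu lam u γin)
    (hS : D.ApproxAssumptions S) (hD : D.Assumptions) (hy : D.toNLP.IsRegular y) {C : ℝ}
    (hC : ∀ t, ‖D.dualGradMu S y (u t)‖ ≤ C ∧ ‖D.dualGradLam (u t)‖ ≤ C) :
    ∃ x, Tendsto u atTop (𝓝 x) ∧ (D.approxNLP S y).IsUniqueOptimal x := by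
  obtain ⟨c, hc⟩ : ∃ c, IsModulus D S c := hS.exists_modulus hD
  obtain ⟨x, mu₀, lam₀, hsad⟩ := exists_isSaddle hD hS hy
  refine ⟨x, ?_, hsad.isUniqueOptimal hD hS hy.1.1⟩
  let V : (Fin rt → ℝ) → (Fin m → ℝ) → ℕ → ℝ := fun mu₀ lam₀ t =>
    ∑ j, (mu t j - mu₀ j) ^ 2 + ∑ l, (lam t l - lam₀ l) ^ 2
  let s : (Fin rt → ℝ) → (Fin m → ℝ) → ℕ → ℝ := fun mu₀ lam₀ t =>
    (mu t - mu₀) ⬝ᵥ D.dualGradMu S y (u t) + (lam t - lam₀) ⬝ᵥ D.dualGradLam (u t)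
  have hV : ∀ mu₀ lam₀ t, 0 ≤ V mu₀ lam₀ t := fun mu₀ lam₀ t =>
    add_nonneg (Finset.sum_nonneg fun _ _ => sq_nonneg _) (Finset.sum_nonneg fun _ _ => sq_nonneg _)
  have hQ : ∀ mu₀ lam₀, IsSaddle D S y x mu₀ lam₀ → ∀ t,
      2 * c * ‖u t - x‖ ^ 2 ≤ -s mu₀ lam₀ t := fun mu₀ lam₀ h t => by
    have h1 := hrun.dotProduct_add_le hc hS hD hy.1.1 h t
    have h2 := mul_le_mul_of_nonneg_left (sq_norm_le_sum_sq_norm (u t - x))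
      (mul_nonneg zero_le_two hc.1.le)
    simp only [Pi.sub_apply] at h2
    simp only [s]
    linarith
  have hs0 : ∀ mu₀ lam₀, IsSaddle D S y x mu₀ lam₀ → ∀ t, 0 ≤ -(2 * s mu₀ lam₀ t) :=
    fun mu₀ lam₀ h t => by
      have := hQ mu₀ lam₀ h t
      have : 0 ≤ 2 * c * ‖u t - x‖ ^ 2 :=
        mul_nonneg (mul_nonneg zero_le_two hc.1.le) (sq_nonneg _)
      linarith
  have hsum : Summable fun t => γin t ^ 2 * ((rt + m) * C ^ 2) := hrun.step_sq.mul_right _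
  have he0 : ∀ t, 0 ≤ γin t ^ 2 * ((rt + m) * C ^ 2) := fun t => by positivity
  have hVlim : ∀ mu₀ lam₀, IsSaddle D S y x mu₀ lam₀ → ∃ ℓ, Tendsto (V mu₀ lam₀) atTop (𝓝 ℓ) :=
    fun mu₀ lam₀ h => exists_tendsto_of_quasiFejer (hV mu₀ lam₀) (hs0 mu₀ lam₀ h) hrun.step_pos
      he0 hsum (hrun.sq_dist_step hC h.nonneg lam₀)
  have hcoord : ∀ mu₀ lam₀ t, ‖mu t - mu₀‖ ^ 2 ≤ V mu₀ lam₀ t ∧ ‖lam t - lam₀‖ ^ 2 ≤ V mu₀ lam₀ t := by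
    have key : ∀ {k : ℕ} (v : Fin k → ℝ), ‖v‖ ^ 2 ≤ ∑ j, v j ^ 2 := fun v => by
      have h0 : 0 ≤ ∑ j, v j ^ 2 := Finset.sum_nonneg fun _ _ => sq_nonneg _
      rw [← Real.le_sqrt (norm_nonneg _) h0]
      refine (pi_norm_le_iff_of_nonneg (Real.sqrt_nonneg _)).2 fun j => ?_
      refine Real.le_sqrt_of_sq_le ?_
      rw [Real.norm_eq_abs, sq_abs]
      exact Finset.single_le_sum (f := fun j => v j ^ 2) (fun _ _ => sq_nonneg _)
        (Finset.mem_univ j)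
    intro mu₀ lam₀ t
    have h1 := key (mu t - mu₀)
    have h2 := key (lam t - lam₀)
    simp only [Pi.sub_apply] at h1 h2
    have h3 : 0 ≤ ∑ j, (mu t j - mu₀ j) ^ 2 := Finset.sum_nonneg fun _ _ => sq_nonneg _
    have h4 : 0 ≤ ∑ l, (lam t l - lam₀ l) ^ 2 := Finset.sum_nonneg fun _ _ => sq_nonneg _
    exact ⟨by simp only [V]; linarith, by simp only [V]; linarith⟩
  -- a subsequence along which the duality gap vanishes and the dual iterates converge
  obtain ⟨φ, hφ, hφs⟩ := extraction_forall_of_frequently fun k : ℕ =>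
    frequently_lt_of_quasiFejer (hV mu₀ lam₀) (hs0 mu₀ lam₀ hsad) hrun.step_pos hrun.step_sum
      he0 hsum (hrun.sq_dist_step hC hsad.nonneg lam₀) (one_div_pos.2 (Nat.cast_add_one_pos k))
  have hφ0 : Tendsto (fun k => -(2 * s mu₀ lam₀ (φ k))) atTop (𝓝 0) :=
    squeeze_zero (fun k => hs0 mu₀ lam₀ hsad _) (fun k => (hφs k).le)
      tendsto_one_div_add_atTop_nhds_zero_nat
  obtain ⟨B, hB⟩ := (hVlim mu₀ lam₀ hsad).choose_spec.bddAbove_range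
  have hbdd : ∀ k, (mu (φ k), lam (φ k)) ∈ Metric.closedBall (mu₀, lam₀) √B := fun k => by
    have h1 := hcoord mu₀ lam₀ (φ k)
    have h2 : V mu₀ lam₀ (φ k) ≤ B := hB ⟨_, rfl⟩
    rw [Metric.mem_closedBall, dist_eq_norm, Prod.mk_sub_mk, Prod.norm_mk]
    exact max_le (Real.le_sqrt_of_sq_le (h1.1.trans h2)) (Real.le_sqrt_of_sq_le (h1.2.trans h2))
  obtain ⟨⟨mu₁, lam₁⟩, -, ψ, hψ, hlim⟩ := tendsto_subseq_of_bounded Metric.isBounded_closedBall hbdd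
  have hs' : Tendsto (fun k => s mu₀ lam₀ (φ (ψ k))) atTop (𝓝 0) := by
    have := (hφ0.comp hψ.tendsto_atTop).const_mul (-(1 / 2))
    rw [mul_zero] at this
    refine this.congr fun k => ?_
    simp only [Function.comp]
    ring
  have hu_of : ∀ (mu₀ : Fin rt → ℝ) (lam₀ : Fin m → ℝ) (θ : ℕ → ℕ), IsSaddle D S y x mu₀ lam₀ →
      Tendsto (fun k => s mu₀ lam₀ (θ k)) atTop (𝓝 0) → Tendsto (u ∘ θ) atTop (𝓝 x) := by
    intro mu₀ lam₀ θ h hθ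
    rw [tendsto_iff_norm_sub_tendsto_zero]
    have h1 : Tendsto (fun k => ‖u (θ k) - x‖ ^ 2) atTop (𝓝 0) := by
      have h2 := (hθ.neg).const_mul (2 * c)⁻¹
      rw [neg_zero, mul_zero] at h2
      refine squeeze_zero (fun k => sq_nonneg _) (fun k => ?_) h2
      have := hQ mu₀ lam₀ h (θ k)
      rw [← div_eq_inv_mul, le_div_iff₀ (mul_pos zero_lt_two hc.1)]
      linarith
    have h3 := h1.sqrt
    simpa [Real.sqrt_sq] using h3
  have hlim1 : Tendsto (mu ∘ (φ ∘ ψ)) atTop (𝓝 mu₁) := (continuous_fst.tendsto _).comp hlim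
  have hlim2 : Tendsto (lam ∘ (φ ∘ ψ)) atTop (𝓝 lam₁) := (continuous_snd.tendsto _).comp hlim
  have hsad₁ : IsSaddle D S y x mu₁ lam₁ := hrun.isSaddle_of_tendsto hS hD hy.1.1 hsad
    (hu_of mu₀ lam₀ (φ ∘ ψ) hsad hs') hlim1 hlim2 hs'
  -- the dual iterates converge to this subsequential limit
  obtain ⟨ℓ, hℓ⟩ := hVlim mu₁ lam₁ hsad₁
  have hℓ0 : ℓ = 0 := by
    refine tendsto_nhds_unique (hℓ.comp (hφ.comp hψ).tendsto_atTop) ?_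
    have h1 : Tendsto (fun k => ∑ j, (mu (φ (ψ k)) j - mu₁ j) ^ 2
        + ∑ l, (lam (φ (ψ k)) l - lam₁ l) ^ 2) atTop
        (𝓝 (∑ j, (mu₁ j - mu₁ j) ^ 2 + ∑ l, (lam₁ l - lam₁ l) ^ 2)) :=
      (tendsto_finsetSum _ fun j _ => ((tendsto_pi_nhds.1 hlim1 j).sub_const _).pow 2).add
        (tendsto_finsetSum _ fun l _ => ((tendsto_pi_nhds.1 hlim2 l).sub_const _).pow 2)
    simp only [sub_self, ne_eq, OfNat.ofNat_ne_zero, not_false_eq_true, zero_pow,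
      Finset.sum_const_zero, add_zero] at h1
    exact h1
  subst hℓ0
  have hsqrt : Tendsto (fun t => √(V mu₁ lam₁ t)) atTop (𝓝 0) := by simpa using hℓ.sqrt
  -- With reference point `(mu₁, lam₁)` the gap is at most the dual distance times the bounded
  -- gradients, now along all `t`.
  refine hu_of mu₁ lam₁ id hsad₁ ?_
  have hdot : ∀ {k : ℕ} (v w : Fin k → ℝ), |v ⬝ᵥ w| ≤ k * (‖v‖ * ‖w‖) := fun {k} v w => by
    refine (Finset.abs_sum_le_sum_abs _ _).trans ?_
    refine (Finset.sum_le_card_nsmul _ _ (‖v‖ * ‖w‖) fun j _ => ?_).trans_eq (by simp)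
    rw [abs_mul]
    exact mul_le_mul (norm_le_pi_norm v j) (norm_le_pi_norm w j) (abs_nonneg _) (norm_nonneg _)
  have hlast : Tendsto (fun t => (rt * (√(V mu₁ lam₁ t) * C) + m * (√(V mu₁ lam₁ t) * C)))
      atTop (𝓝 0) := by
    simpa using ((hsqrt.mul_const C).const_mul (rt : ℝ)).add ((hsqrt.mul_const C).const_mul (m : ℝ))
  refine squeeze_zero_norm (fun t => ?_) hlast
  rw [Real.norm_eq_abs]
  have h1 := hcoord mu₁ lam₁ t
  have h2 := Real.le_sqrt_of_sq_le h1.1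
  have h3 := Real.le_sqrt_of_sq_le h1.2
  refine (abs_add_le _ _).trans (add_le_add ?_ ?_)
  · refine (hdot _ _).trans ?_
    have := (hC t).1
    simp only [id]
    gcongr
  · refine (hdot _ _).trans ?_
    have := (hC t).2
    simp only [id]
    gcongr

/-- Convergence of `u` bounds the dual gradients by continuity, so the bounded case identifies the
limit. -/
theorem isUniqueOptimal_of_tendsto (hrun : D.IsInnerRun S y mu lam u γin)
    (hS : D.ApproxAssumptions S) (hD : D.Assumptions) (hy : D.toNLP.IsRegular y)
    {x : BlockVec n} (hu : Tendsto u atTop (𝓝 x)) : (D.approxNLP S y).IsUniqueOptimal x := by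
  have hx : x ∈ D.toNLP.X := hD.isClosed_X.mem_of_tendsto hu (Eventually.of_forall hrun.mem_X)
  have h1 : Tendsto (fun t => D.dualGradMu S y (u t)) atTop (𝓝 (D.dualGradMu S y x)) :=
    tendsto_finsetSum _ fun i _ => (hS.hasFDerivAt_Gt (hx i) (hy.1.1 i)).continuousAt.tendsto.comp
      (tendsto_pi_nhds.1 hu i)
  have h2 : Tendsto (fun t => D.dualGradLam (u t)) atTop (𝓝 (D.dualGradLam x)) :=
    (D.continuous_coupling.tendsto x).comp hu
  obtain ⟨B₁, hB₁⟩ := h1.norm.bddAbove_range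
  obtain ⟨B₂, hB₂⟩ := h2.norm.bddAbove_range
  obtain ⟨x', hx', hopt⟩ := hrun.tendsto_of_bounded hS hD hy (C := max B₁ B₂) fun t =>
    ⟨(hB₁ ⟨t, rfl⟩).trans (le_max_left _ _), (hB₂ ⟨t, rfl⟩).trans (le_max_right _ _)⟩
  rwa [tendsto_nhds_unique hu hx']

end IsInnerRun

end SDDProblem

end Inner

/-! ### The outer loop: small directions, descent and stationary limits. -/

/-- A sequence with steps `γ d`, `∑ γ = ∞`, `∑ γ ‖d‖² < ∞`, that does not tend to infinity has
arbitrarily small directions `d` at infinitely many of its points in some fixed ball. -/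
theorem exists_frequently_norm_le_and_norm_lt {E : Type*} [NormedAddCommGroup E]
    [NormedSpace ℝ E] {x d : ℕ → E} {γ : ℕ → ℝ} (hγ : ∀ k, 0 < γ k)
    (hγs : Tendsto (fun K => ∑ k ∈ Finset.range K, γ k) atTop atTop)
    (hsum : Summable fun k => γ k * ‖d k‖ ^ 2) (hx : ∀ k, x (k + 1) = x k + γ k • d k)
    (hbd : ¬ Tendsto (fun k => ‖x k‖) atTop atTop) :
    ∃ R : ℝ, ∀ δ : ℝ, 0 < δ → ∃ᶠ k in atTop, ‖x k‖ ≤ R ∧ ‖d k‖ < δ := by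
  rw [tendsto_atTop] at hbd
  push Not at hbd
  obtain ⟨R₀, hR₀⟩ := hbd
  -- The radius does not depend on `δ`, so one compact ball serves all `δ`. The extra 1 is the
  -- distance the sequence may move away from a point of norm less than `R₀`.
  refine ⟨R₀ + 1, fun δ hδ hn => ?_⟩
  set s : ℕ → ℝ := fun T => ∑ k ∈ Finset.range T, γ k * ‖d k‖ ^ 2 with hs
  have ha0 : ∀ k, 0 ≤ γ k * ‖d k‖ ^ 2 := fun k => mul_nonneg (hγ k).le (sq_nonneg _)
  have htail : ∀ᶠ k in atTop, (∑' k, γ k * ‖d k‖ ^ 2) - δ < s k :=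
    hsum.hasSum.tendsto_sum_nat.eventually_const_lt (sub_lt_self _ hδ)
  obtain ⟨N, hN⟩ := eventually_atTop.1 (hn.and htail)
  obtain ⟨k₀, hk₀, hk₀N⟩ := (hR₀.and_eventually (eventually_ge_atTop N)).exists
  have hle : ∀ b, s b - s k₀ < δ := fun b => by
    have h1 : s b ≤ ∑' k, γ k * ‖d k‖ ^ 2 := hsum.sum_le_tsum _ fun k _ => ha0 k
    have h2 := (hN k₀ hk₀N).2
    linarith
  have hd_of : ∀ j, δ * ‖x (k₀ + j) - x k₀‖ ≤ s (k₀ + j) - s k₀ → δ ≤ ‖d (k₀ + j)‖ := by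
    intro j hj
    have h1 : ‖x (k₀ + j) - x k₀‖ < 1 := by
      have := hj.trans_lt (hle _)
      nlinarith
    have h2 : ‖x (k₀ + j)‖ ≤ R₀ + 1 := by
      have := norm_le_norm_add_norm_sub' (x (k₀ + j)) (x k₀)
      linarith
    by_contra! h
    exact (hN (k₀ + j) (by omega)).1 ⟨h2, h⟩
  -- While the directions have norm at least `δ`, the path length times `δ` is at most the sum of `γ
  -- k * ‖d k‖ ^ 2`. That tail is below `δ`, so the sequence moves by less than 1, stays in the
  -- ball, and its next direction is again not small.
  have hP : ∀ j, δ * ‖x (k₀ + j) - x k₀‖ ≤ s (k₀ + j) - s k₀ := by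
    intro j
    induction j with
    | zero => simp
    | succ j ih =>
      have h1 := hd_of j ih
      have h2 : s (k₀ + (j + 1)) = s (k₀ + j) + γ (k₀ + j) * ‖d (k₀ + j)‖ ^ 2 := by
        simp only [hs, ← add_assoc, Finset.sum_range_succ]
      have h3 : ‖x (k₀ + (j + 1)) - x k₀‖ ≤ ‖x (k₀ + j) - x k₀‖ + γ (k₀ + j) * ‖d (k₀ + j)‖ := by
        rw [← add_assoc, hx, add_sub_right_comm]
        refine (norm_add_le _ _).trans_eq ?_
        rw [norm_smul, Real.norm_of_nonneg (hγ _).le]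
      have h4 : δ * (γ (k₀ + j) * ‖d (k₀ + j)‖) ≤ γ (k₀ + j) * ‖d (k₀ + j)‖ ^ 2 := by
        have := mul_le_mul_of_nonneg_left h1 (mul_nonneg (hγ (k₀ + j)).le (norm_nonneg (d (k₀ + j))))
        linarith
      have h5 := mul_le_mul_of_nonneg_left h3 hδ.le
      rw [h2]
      linarith
  have hdall : ∀ k, k₀ ≤ k → δ ≤ ‖d k‖ := fun k hk => by
    obtain ⟨j, rfl⟩ := Nat.exists_eq_add_of_le hk
    exact hd_of j (hP j)
  -- Beyond `δ / δ ^ 2` of total step size, directions of norm at least `δ` would exceed the tail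
  -- bound `δ`.
  obtain ⟨T, hT, hTk⟩ := ((hγs.eventually_gt_atTop (∑ k ∈ Finset.range k₀, γ k + δ / δ ^ 2)).and
    (eventually_ge_atTop k₀)).exists
  rw [← Finset.sum_range_add_sum_Ico _ hTk] at hT
  have h1 : δ / δ ^ 2 < ∑ k ∈ Finset.Ico k₀ T, γ k := by linarith
  rw [div_lt_iff₀ (by positivity), Finset.sum_mul] at h1
  have h2 : ∑ k ∈ Finset.Ico k₀ T, γ k * δ ^ 2 ≤ ∑ k ∈ Finset.Ico k₀ T, γ k * ‖d k‖ ^ 2 :=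
    Finset.sum_le_sum fun k hk => mul_le_mul_of_nonneg_left
      (pow_le_pow_left₀ hδ.le (hdall k (Finset.mem_Ico.1 hk).1) 2) (hγ k).le
  rw [Finset.sum_Ico_eq_sub (fun k => γ k * ‖d k‖ ^ 2) hTk] at h2
  have h3 := hle T
  simp only [hs] at h3
  linarith

section Outer

variable {I : ℕ} {n r : Fin I → ℕ} {rt m : ℕ}

theorem continuous_blockConstraintDeriv (j : Fin rt ⊕ (Σ i, Fin (r i))) :
    Continuous fun p : (∀ i, EuclideanSpace ℝ (Fin (n i)) →L[ℝ] (Fin rt → ℝ)) ×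
      (∀ i, EuclideanSpace ℝ (Fin (n i)) →L[ℝ] (Fin (r i) → ℝ)) =>
      blockConstraintDeriv p.1 p.2 j := by
  rcases j with j | ⟨i, j⟩
  · simp only [blockConstraintDeriv, Sum.elim_inl]
    refine continuous_blockSum.comp (continuous_pi fun i => ?_)
    fun_prop
  · simp only [blockConstraintDeriv, Sum.elim_inr]
    fun_prop

namespace SDDProblem

variable {D : SDDProblem n r rt m} {S : SDDApprox n r rt}

theorem fritzJohnDeriv_smul (D : SDDProblem n r rt m) (S : SDDApprox n r rt) (y x : BlockVec n)
    (a α : ℝ) (mu : Fin rt ⊕ (Σ i, Fin (r i)) → ℝ) (lam : Fin m → ℝ) :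
    D.fritzJohnDeriv S y x (a * α) (a • mu) (a • lam) = a • D.fritzJohnDeriv S y x α mu lam := by
  simp only [fritzJohnDeriv, smul_add, Finset.smul_sum, Pi.smul_apply, smul_smul, smul_eq_mul]

/-- Norm one makes the multipliers relatively compact without any bound on KKT multipliers. -/
theorem exists_normalized_fritzJohn (hD : D.Assumptions) (hS : D.ApproxAssumptions S)
    {x y : BlockVec n} (hy : y ∈ D.toNLP.X) (hx : (D.approxNLP S y).IsOptimal x) :
    ∃ p : ℝ × (Fin rt ⊕ (Σ i, Fin (r i)) → ℝ) × (Fin m → ℝ), ‖p‖ = 1 ∧ 0 ≤ p.1 ∧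
      (∀ j, 0 ≤ p.2.1 j) ∧ (∀ j, p.2.1 j * (D.approxNLP S y).g j x = 0) ∧
      ∀ z ∈ D.toNLP.X, 0 ≤ D.fritzJohnDeriv S y x p.1 p.2.1 p.2.2 (z - x) := by
  obtain ⟨α, mu, lam, hne, hα, hmu, hcomp, hmin⟩ := exists_fritzJohn_approxNLP hD hS hy hx
  have hpos : 0 < ‖(α, mu, lam)‖⁻¹ := inv_pos.2 (norm_pos_iff.2 hne)
  refine ⟨‖(α, mu, lam)‖⁻¹ • (α, mu, lam), norm_smul_inv_norm (𝕜 := ℝ) hne,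
    mul_nonneg hpos.le hα, fun j => mul_nonneg hpos.le (hmu j), fun j => ?_, fun z hz => ?_⟩
  · simp only [Prod.smul_mk, Pi.smul_apply, smul_eq_mul, mul_assoc, hcomp, mul_zero]
  · have h1 : ∑ j, mu j * (D.approxNLP S y).g j x = 0 := Finset.sum_eq_zero fun j _ => hcomp j
    have hh : ∀ l, D.coupling x l = 0 := hx.1.2.2
    have h2 := IsMinOn.fderiv_sub_nonneg hD.convex_X (fun w hw => by
      have := hmin w hw
      simpa [hh, h1] using this) hx.1.1 hz (hS.hasFDerivAt_fritzJohn hD hx.1.1 hy α mu lam)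
    have h3 := D.fritzJohnDeriv_smul S y x ‖(α, mu, lam)‖⁻¹ α mu lam
    simp only [Prod.smul_mk, smul_eq_mul] at h3 ⊢
    rw [h3]
    exact mul_nonneg hpos.le h2

/-- A limit of points whose approximate problems have optimal points with the same limit. -/
theorem isStationary_of_tendsto (hD : D.Assumptions) (hS : D.ApproxAssumptions S)
    {x xs : ℕ → BlockVec n} {xbar : BlockVec n} (hx : ∀ k, x k ∈ D.toNLP.feasible)
    (hopt : ∀ k, (D.approxNLP S (x k)).IsOptimal (xs k)) (hreg : D.toNLP.IsRegular xbar)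
    (hxl : Tendsto x atTop (𝓝 xbar)) (hxsl : Tendsto xs atTop (𝓝 xbar)) :
    D.toNLP.IsStationary xbar := by
  have hbX := hreg.1.1
  choose p hp1 hp2 hp3 hp4 hp5 using fun k => exists_normalized_fritzJohn hD hS (hx k).1 (hopt k)
  obtain ⟨q, hq, φ, hφ, hlim⟩ := (isCompact_sphere
    (0 : ℝ × (Fin rt ⊕ (Σ i, Fin (r i)) → ℝ) × (Fin m → ℝ)) 1).tendsto_subseq
    (x := p) fun k => by simp [hp1]
  have hxφ := hxl.comp hφ.tendsto_atTop
  have hxsφ := hxsl.comp hφ.tendsto_atTop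
  have hq1 : Tendsto (fun k => (p (φ k)).1) atTop (𝓝 q.1) := (continuous_fst.tendsto _).comp hlim
  have hq2 : Tendsto (fun k => (p (φ k)).2.1) atTop (𝓝 q.2.1) :=
    ((continuous_fst.comp continuous_snd).tendsto _).comp hlim
  have hq3 : Tendsto (fun k => (p (φ k)).2.2) atTop (𝓝 q.2.2) :=
    ((continuous_snd.comp continuous_snd).tendsto _).comp hlim
  have hpair : ∀ i, Tendsto (fun k => (xs (φ k) i, x (φ k) i)) atTop
      (𝓝[D.X i ×ˢ D.X i] (xbar i, xbar i)) := fun i =>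
    tendsto_nhdsWithin_iff.2 ⟨(tendsto_pi_nhds.1 hxsφ i).prodMk_nhds (tendsto_pi_nhds.1 hxφ i),
      Eventually.of_forall fun k => ⟨(hopt (φ k)).1.1 i, (hx (φ k)).1 i⟩⟩
  have hmem : ∀ i, (xbar i, xbar i) ∈ D.X i ×ˢ D.X i := fun i => ⟨hbX i, hbX i⟩
  have hF : Tendsto (fun k i => fderiv ℝ (fun z => S.F i z (x (φ k) i)) (xs (φ k) i)) atTop
      (𝓝 fun i => fderiv ℝ (fun z => S.F i z (xbar i)) (xbar i)) :=
    tendsto_pi_nhds.2 fun i => (((hS.objective i).grad_continuous.mono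
      (Set.prod_mono (hD.subset i) subset_rfl)) _ (hmem i)).tendsto.comp (hpair i)
  have hGt : Tendsto (fun k i => fderiv ℝ (fun z => S.Gt i z (x (φ k) i)) (xs (φ k) i)) atTop
      (𝓝 fun i => fderiv ℝ (fun z => S.Gt i z (xbar i)) (xbar i)) :=
    tendsto_pi_nhds.2 fun i => ((hS.coupling i).grad_continuous _ (hmem i)).tendsto.comp (hpair i)
  have hG : Tendsto (fun k i => fderiv ℝ (fun z => S.G i z (x (φ k) i)) (xs (φ k) i)) atTop
      (𝓝 fun i => fderiv ℝ (fun z => S.G i z (xbar i)) (xbar i)) :=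
    tendsto_pi_nhds.2 fun i => ((hS.block i).grad_continuous _ (hmem i)).tendsto.comp (hpair i)
  have hderiv : Tendsto (fun k => D.fritzJohnDeriv S (x (φ k)) (xs (φ k)) (p (φ k)).1
      (p (φ k)).2.1 (p (φ k)).2.2) atTop
      (𝓝 (D.fritzJohnDeriv S xbar xbar q.1 q.2.1 q.2.2)) := by
    refine ((hq1.smul ((continuous_blockSum.tendsto _).comp hF)).add
      (tendsto_finsetSum _ fun j _ => (tendsto_pi_nhds.1 hq2 j).smul
        (((continuous_blockConstraintDeriv j).tendsto _).comp (hGt.prodMk_nhds hG)))).add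
      (tendsto_finsetSum _ fun l _ => (tendsto_pi_nhds.1 hq3 l).smul_const _)
  have hmu : ∀ j, 0 ≤ q.2.1 j := fun j =>
    ge_of_tendsto' (tendsto_pi_nhds.1 hq2 j) fun k => hp3 _ j
  have hα : 0 ≤ q.1 := ge_of_tendsto' hq1 fun k => hp2 _
  have hst : ∀ z ∈ D.toNLP.X,
      0 ≤ D.fritzJohnDeriv S xbar xbar q.1 q.2.1 q.2.2 (z - xbar) := fun z hz =>
    ge_of_tendsto' (((isBoundedBilinearMap_apply (𝕜 := ℝ) (E := BlockVec n)
      (F := ℝ)).continuous.tendsto (_, _)).comp (hderiv.prodMk_nhds (hxsφ.const_sub z)))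
      fun k => hp5 (φ k) z hz
  have hgl : ∀ j, Tendsto (fun k => (D.approxNLP S (x (φ k))).g j (xs (φ k))) atTop
      (𝓝 (D.toNLP.g j xbar)) := by
    intro j
    rw [← hS.approxNLP_g_self hbX]
    rcases j with j | ⟨i, j⟩
    · exact tendsto_finsetSum Finset.univ fun i _ => tendsto_pi_nhds.1
        (((hS.coupling i).continuous _ (hmem i)).tendsto.comp (hpair i)) j
    · exact tendsto_pi_nhds.1 (((hS.block i).continuous _ (hmem i)).tendsto.comp (hpair i)) j
  have hcomp : ∀ j, q.2.1 j * D.toNLP.g j xbar = 0 := fun j =>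
    tendsto_nhds_unique ((tendsto_pi_nhds.1 hq2 j).mul (hgl j))
      (tendsto_const_nhds.congr fun k => (hp4 (φ k) j).symm)
  -- With zero weight, the limit multipliers would satisfy the MFCQ system at `xbar` and vanish,
  -- although their norm is one.
  have hα0 : 0 < q.1 := by
    refine hα.lt_of_ne' fun h0 => ?_
    rw [h0] at hst
    obtain ⟨h1, h2⟩ := eq_zero_of_isRegular hD hS hreg hmu hcomp hst
    have : q = 0 := Prod.ext h0 (Prod.ext h1 h2)
    simp [this] at hq
  refine ⟨q.1⁻¹ • q.2.1, q.1⁻¹ • q.2.2, fun z hz => ?_, fun j => ?_, fun j => ?_, hreg.1⟩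
  · have h1 := D.fritzJohnDeriv_smul S xbar xbar q.1⁻¹ q.1 q.2.1 q.2.2
    rw [inv_mul_cancel₀ hα0.ne', fritzJohnDeriv_self hD hS hbX, one_smul] at h1
    rw [h1]
    exact mul_nonneg (inv_pos.2 hα0).le (hst z hz)
  · rw [Pi.smul_apply, smul_eq_mul, mul_assoc, hcomp, mul_zero]
  · exact mul_nonneg (inv_pos.2 hα0).le (hmu j)

/-! ### The outer iterates -/

/-- The feasible set of the approximate problem at `x` is convex, contains `x` and lies inside the
original feasible set, since the approximations majorize. -/
theorem add_smul_sub_mem_feasible (hD : D.Assumptions) (hS : D.ApproxAssumptions S)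
    {x z : BlockVec n} (hx : x ∈ D.toNLP.feasible) (hz : z ∈ (D.approxNLP S x).feasible)
    {a : ℝ} (h0 : 0 ≤ a) (h1 : a ≤ 1) : x + a • (z - x) ∈ D.toNLP.feasible := by
  have hxa := hS.self_mem_feasible hx
  have hm : x + a • (z - x) ∈ D.toNLP.X := hD.convex_X.add_smul_sub_mem hx.1 hz.1 ⟨h0, h1⟩
  have e : x + a • (z - x) = (1 - a) • x + a • z := by module
  refine ⟨hm, fun j => (hS.toNLP_g_le hm hx.1 j).trans ?_, fun l => ?_⟩
  · have h2 := (hS.convexOn_approxNLP_g hD hx.1 j).2 hx.1 hz.1 (sub_nonneg.2 h1) h0 (by ring)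
    rw [e]
    simp only [smul_eq_mul] at h2
    nlinarith [mul_nonneg h0 (neg_nonneg.2 (hz.2.1 j)),
      mul_nonneg (sub_nonneg.2 h1) (neg_nonneg.2 (hxa.2.1 j))]
  · have h2 : D.coupling x l = 0 := hx.2.2 l
    have h3 : D.coupling z l = 0 := hz.2.2 l
    change D.coupling _ l = 0
    rw [e, D.coupling_affine l x z _ _ (by ring), h2, h3]
    simp

/-- Lipschitz gradients and the mean value inequality on each block; the sum of the Lipschitz
constants bounds each of them. -/
theorem exists_descent_const (hD : D.Assumptions) : ∃ K : ℝ, 0 ≤ K ∧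
    ∀ x ∈ D.toNLP.X, ∀ z ∈ D.toNLP.X, ∀ a : ℝ, 0 ≤ a → a ≤ 1 →
      D.toNLP.f (x + a • (z - x)) ≤ D.toNLP.f x
        + a * (blockSum fun i => fderiv ℝ (D.f i) (x i)) (z - x)
        + K * a ^ 2 * ∑ i, ‖z i - x i‖ ^ 2 := by
  choose K hK using hD.f_lipschitz
  refine ⟨∑ i, (K i : ℝ), Finset.sum_nonneg fun i _ => (K i).2, fun x hx z hz a h0 h1 => ?_⟩
  rw [blockSum_apply, Finset.mul_sum, Finset.mul_sum]
  simp only [toNLP, ← Finset.sum_add_distrib]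
  refine Finset.sum_le_sum fun i _ => ?_
  simp only [Pi.add_apply, Pi.smul_apply, Pi.sub_apply]
  set v := z i - x i with hv
  have hseg : segment ℝ (x i) (x i + a • v) ⊆ D.X i := (hD.convex i).segment_subset (hx i)
    ((hD.convex i).add_smul_sub_mem (hx i) (hz i) ⟨h0, h1⟩)
  have h2 := (convex_segment (x i) (x i + a • v)).norm_image_sub_le_of_norm_hasFDerivWithin_le'
    (f := D.f i) (f' := fun w => fderiv ℝ (D.f i) w) (φ := fderiv ℝ (D.f i) (x i))
    (C := K i * (a * ‖v‖))
    (fun w hw => (hD.hasFDerivAt_f (hseg hw)).hasFDerivWithinAt) (fun w hw => by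
      refine ((hK i).norm_sub_le (hseg hw) (hx i)).trans ?_
      have h3 := norm_sub_le_of_mem_segment hw
      rw [add_sub_cancel_left, norm_smul, Real.norm_of_nonneg h0] at h3
      gcongr) (left_mem_segment ℝ _ _) (right_mem_segment ℝ _ _)
  rw [add_sub_cancel_left, map_smul, norm_smul, Real.norm_of_nonneg h0, smul_eq_mul,
    Real.norm_eq_abs] at h2
  have h3 := (abs_le.1 h2).2
  have h4 : (K i : ℝ) * (a * ‖v‖) * (a * ‖v‖) ≤ (∑ i, (K i : ℝ)) * a ^ 2 * ‖v‖ ^ 2 := by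
    have h5 : (K i : ℝ) ≤ ∑ i, (K i : ℝ) :=
      Finset.single_le_sum (f := fun i => (K i : ℝ)) (fun i _ => (K i).2) (Finset.mem_univ i)
    have := mul_le_mul_of_nonneg_right h5 (mul_nonneg (sq_nonneg a) (sq_nonneg ‖v‖))
    linarith
  linarith

/-- `x` is a competitor of the optimal point `z`, and the gradients of `F` and `f` agree at `x`, so
the strong convexity inequality bounds the slope of `f`. -/
theorem blockSum_fderiv_sub_le {c : ℝ} (hc : IsModulus D S c) (hS : D.ApproxAssumptions S)
    {x z : BlockVec n} (hx : x ∈ D.toNLP.feasible) (hz : (D.approxNLP S x).IsOptimal z) :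
    (blockSum fun i => fderiv ℝ (D.f i) (x i)) (z - x) ≤ -(c * ∑ i, ‖z i - x i‖ ^ 2) := by
  have h1 := hc.approxNLP_f_le hx.1 hx.1 hz.1.1
  have h2 := hz.2 x (hS.self_mem_feasible hx)
  simp only [fun i => (hS.objective i).grad_eq _ (hx.1 i)] at h1
  linarith

namespace IsSDDRun

variable {x xs : ℕ → BlockVec n} {γ : ℕ → ℝ}

/-- Feasibility of `x k` gives optimality of `xs k`, which in turn gives feasibility of `x (k + 1)`.
-/
theorem feasible_and_isOptimal (hrun : D.IsSDDRun S x xs γ) (hD : D.Assumptions)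
    (hS : D.ApproxAssumptions S) (hreg : ∀ x ∈ D.toNLP.feasible, D.toNLP.IsRegular x) (k : ℕ) :
    x k ∈ D.toNLP.feasible ∧ (D.approxNLP S (x k)).IsOptimal (xs k) := by
  have hopt : ∀ k, x k ∈ D.toNLP.feasible → (D.approxNLP S (x k)).IsOptimal (xs k) := by
    intro k hk
    obtain ⟨mu, lam, u, γin, hin, hu⟩ := hrun.inner k
    exact (hin.isUniqueOptimal_of_tendsto hS hD (hreg _ hk) hu).1
  have hfeas : x k ∈ D.toNLP.feasible := by
    induction k with
    | zero => exact hrun.init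
    | succ k ih =>
      rw [hrun.update]
      exact add_smul_sub_mem_feasible hD hS ih (hopt k ih).1 (hrun.step_pos k).le
        (hrun.step_le_one k)
  exact ⟨hfeas, hopt k hfeas⟩

/-- Once `K * γ k < c / 2`, at least half of the first-order decrease survives the quadratic error;
the decreases telescope against the lower bound of `f`. -/
theorem summable_step (hrun : D.IsSDDRun S x xs γ) (hD : D.Assumptions)
    (hS : D.ApproxAssumptions S) (hreg : ∀ x ∈ D.toNLP.feasible, D.toNLP.IsRegular x) :
    Summable fun k => γ k * ‖xs k - x k‖ ^ 2 := by
  obtain ⟨c, hc⟩ : ∃ c, IsModulus D S c := hS.exists_modulus hD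
  obtain ⟨K, hK0, hK⟩ := exists_descent_const hD
  obtain ⟨B, hB⟩ := hD.bddBelow
  have hfo := hrun.feasible_and_isOptimal hD hS hreg
  have hsmall : ∀ᶠ k in atTop, K * γ k < c / 2 := by
    have := hrun.step_tendsto.const_mul K
    rw [mul_zero] at this
    exact this.eventually_lt_const (half_pos hc.1)
  obtain ⟨N, hN⟩ := eventually_atTop.1 hsmall
  have hstep : ∀ k, N ≤ k →
      D.toNLP.f (x (k + 1)) + c / 2 * (γ k * ‖xs k - x k‖ ^ 2) ≤ D.toNLP.f (x k) := by
    intro k hk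
    have h1 := hK (x k) (hfo k).1.1 (xs k) (hfo k).2.1.1 (γ k) (hrun.step_pos k).le
      (hrun.step_le_one k)
    rw [← hrun.update] at h1
    have h2 := mul_le_mul_of_nonneg_left (blockSum_fderiv_sub_le hc hS (hfo k).1 (hfo k).2)
      (hrun.step_pos k).le
    have h3 := sq_norm_le_sum_sq_norm (xs k - x k)
    simp only [Pi.sub_apply] at h3
    set Q := ∑ i, ‖xs k i - x k i‖ ^ 2
    have hQ : 0 ≤ Q := (sq_nonneg _).trans h3
    have h4 : K * γ k * (γ k * Q) ≤ c / 2 * (γ k * Q) :=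
      mul_le_mul_of_nonneg_right (hN k hk).le (mul_nonneg (hrun.step_pos k).le hQ)
    have h5 : c / 2 * (γ k * ‖xs k - x k‖ ^ 2) ≤ c / 2 * (γ k * Q) :=
      mul_le_mul_of_nonneg_left (mul_le_mul_of_nonneg_left h3 (hrun.step_pos k).le)
        (half_pos hc.1).le
    linarith
  refine (summable_nat_add_iff N).1 (summable_of_sum_range_le
    (c := (D.toNLP.f (x N) - B) / (c / 2))
    (fun k => mul_nonneg (hrun.step_pos _).le (sq_nonneg _)) fun T => ?_)
  rw [le_div_iff₀ (half_pos hc.1)]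
  have key : D.toNLP.f (x (T + N))
      + (∑ k ∈ Finset.range T, γ (k + N) * ‖xs (k + N) - x (k + N)‖ ^ 2) * (c / 2)
      ≤ D.toNLP.f (x N) := by
    induction T with
    | zero => simp
    | succ T ih =>
      have := hstep (T + N) (by omega)
      rw [Finset.sum_range_succ, add_mul, show T + 1 + N = T + N + 1 by omega]
      linarith
  have hb : B ≤ D.toNLP.f (x (T + N)) := hB ⟨_, (hfo _).1, rfl⟩
  linarith

theorem exists_isStationary (hrun : D.IsSDDRun S x xs γ) (hD : D.Assumptions)
    (hS : D.ApproxAssumptions S) (hreg : ∀ x ∈ D.toNLP.feasible, D.toNLP.IsRegular x)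
    (hbd : ¬ Tendsto (fun k => ‖x k‖) atTop atTop) :
    ∃ xbar, MapClusterPt xbar atTop x ∧ D.toNLP.IsStationary xbar := by
  have hfo := hrun.feasible_and_isOptimal hD hS hreg
  obtain ⟨R, hR⟩ := exists_frequently_norm_le_and_norm_lt hrun.step_pos hrun.step_sum
    (hrun.summable_step hD hS hreg) hrun.update hbd
  -- A diagonal choice with `δ = 1 / (k + 1)` and the same radius `R`.
  obtain ⟨φ, hφ, hφR⟩ := extraction_forall_of_frequently fun k : ℕ =>
    hR (1 / ((k : ℝ) + 1)) (one_div_pos.2 (Nat.cast_add_one_pos k))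
  obtain ⟨xbar, -, ψ, hψ, hlim⟩ := tendsto_subseq_of_bounded
    (Metric.isBounded_closedBall (x := (0 : BlockVec n)) (r := R)) (x := x ∘ φ)
    fun k => by simpa using (hφR k).1
  have hd : Tendsto (fun k => xs (φ k) - x (φ k)) atTop (𝓝 0) :=
    squeeze_zero_norm (fun k => (hφR k).2.le) tendsto_one_div_add_atTop_nhds_zero_nat
  have hxs : Tendsto (fun k => xs (φ (ψ k))) atTop (𝓝 xbar) := by
    simpa using (hd.comp hψ.tendsto_atTop).add hlim
  have hbar : xbar ∈ D.toNLP.feasible :=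
    hD.isClosed_feasible.mem_of_tendsto hlim (Eventually.of_forall fun k => (hfo _).1)
  exact ⟨xbar, hlim.mapClusterPt.of_comp (hφ.comp hψ).tendsto_atTop,
    isStationary_of_tendsto hD hS (fun k => (hfo _).1) (fun k => (hfo _).2) (hreg _ hbar) hlim hxs⟩

end IsSDDRun

end SDDProblem

end Outer

end

theorem mainTheorem9 {I : ℕ} {n r : Fin I → ℕ} {rt m : ℕ}
    (D : SDDProblem n r rt m) (S : SDDApprox n r rt)
    (hD : D.Assumptions) (hS : D.ApproxAssumptions S)
    (hreg : ∀ x ∈ D.toNLP.feasible, D.toNLP.IsRegular x) :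
    -- every subproblem of the inner loop has a unique optimal point
    (∀ y ∈ D.toNLP.feasible, ∀ (mu : Fin rt → ℝ) (lam : Fin m → ℝ), (∀ j, 0 ≤ mu j) →
      ∀ i, ∃! x, D.IsSubOptimal S i (y i) mu lam x) ∧
    -- the inner loop converges as soon as the dual gradients that it uses stay bounded
    (∀ y ∈ D.toNLP.feasible, ∀ mu lam u γin, D.IsInnerRun S y mu lam u γin →
      (∃ C : ℝ, ∀ t, ‖D.dualGradMu S y (u t)‖ ≤ C ∧ ‖D.dualGradLam (u t)‖ ≤ C) →
      ∃ xs, Tendsto u atTop (𝓝 xs)) ∧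
    -- what the inner loop delivers is the unique optimal point of the convex approximate problem
    (∀ y ∈ D.toNLP.feasible, ∀ mu lam u γin, D.IsInnerRun S y mu lam u γin →
      ∀ xs, Tendsto u atTop (𝓝 xs) → (D.approxNLP S y).IsUniqueOptimal xs) ∧
    -- at least one limit point of the outer iterates is a stationary point
    (∀ x xs γ, D.IsSDDRun S x xs γ → ¬ Tendsto (fun k => ‖x k‖) atTop atTop →
      ∃ xbar, MapClusterPt xbar atTop x ∧ D.toNLP.IsStationary xbar) := by
  refine ⟨fun y hy mu lam hmu i => SDDProblem.existsUnique_isSubOptimal hD hS hy lam hmu i,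
    fun y hy mu lam u γin hrun ⟨C, hC⟩ => ?_,
    fun y hy mu lam u γin hrun xs hu => hrun.isUniqueOptimal_of_tendsto hS hD (hreg y hy) hu,
    fun x xs γ hrun hbd => hrun.exists_isStationary hD hS hreg hbd⟩
  obtain ⟨xs, hxs, -⟩ := hrun.tendsto_of_bounded hS hD (hreg y hy) hC
  exact ⟨xs, hxs⟩
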